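/- Consider an $L_0$-regular $gl(2)$ spin chain of length $L$ ($L_0\mid L$): the spins $s_1,\dots,s_{L_0}\in\frac12\mathbb Z_{>0}$ are repeated periodically, $\mathcal S$ is the set of their values and $\rho_s$ is the proportion of the value $s\in\mathcal S$. Put $\varphi_r(\lambda)=2\arctan(2\lambda/r)$ for $r>0$, $\varphi_0=0$, and for $p\in\mathbb Z_{>0}$, $m,n\in\frac12\mathbb Z_{>0}$ $$\Phi_p^{(m)}=\sum_{\alpha=|\frac p2-m+\frac12|+1}^{\frac p2+m-\frac12}\varphi_{2\alpha}+\theta(p>2m-1)\,\varphi_{p-2m+1},\qquad \Phi_2^{(n,m)}=\varphi_{2n+2m}+\varphi_{2|n-m|}+2\sum_{\alpha=|n-m|+1}^{n+m-1}\varphi_{2\alpha},\qquad \Psi_p^{(m)}=\frac{d}{d\lambda}\Phi_p^{(m)}.$$ Fix integers $\mu_s$ ($s\in\mathcal S$) and finitely supported integers $\tilde\nu_r\ge0$ ($r\in\frac12\mathbb Z_{>0}\setminus\mathcal S$), and put $\tilde\nu_s=\frac{L\rho_s}2-\mu_s$ for $s\in\mathcal S$ (for $L$ such that these are nonnegative integers).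 Let $$\tilde P_m=2\sum_{j=1}^L\min(m,s_j)-4\sum_n\min(m,n)\tilde\nu_n+\tilde\nu_m ,\qquad \mathcal D_s=\tilde P_s-\tilde\nu_s\quad(s\in\mathcal S).$$ A Bethe state in this configuration (in the string hypothesis) consists of real centers $\lambda_{m,k}$ ($1\le k\le\tilde\nu_m$) of $2m$-strings and, for each $m$, pairwise distinct quantum numbers $Q_{m,k}\in\{\frac{1-\tilde P_m}2,\frac{3-\tilde P_m}{2},\dots,\frac{\tilde P_m-1}2\}$ such that $z_m(\lambda_{m,k})=2\pi Q_{m,k}$, where $$z_m(\lambda)=L\sum_{s\in\mathcal S}\rho_s\Phi_{2s}^{(m)}(\lambda)-\sum_{p\in\frac12\mathbb Z_{>0}}\sum_{\ell=1}^{\tilde\nu_p}\Phi_2^{(p,m)}(\lambda-\lambda_{p,\ell}).$$ The $\mathcal D_s$ unused quantum numbers $\tilde Q_{s,d}$ of the sea of $2s$-strings define the hole rapidities by $z_s(\tilde\lambda_{s,d})=2\pi\tilde Q_{s,d}$; it is part of the definition that for $s\in\mathcal S$ and every $q\in\frac{1-\tilde P_s}2+\mathbb Z$ the equation $z_s(\lambda)=2\pi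 q$ has at most one real solution. The energies are $E^{(s)}=-\sum_m\sum_{k=1}^{\tilde\nu_m}\Psi_{2s}^{(m)}(\lambda_{m,k})$, $s\in\mathcal S$. With $\psi$ the digamma function, let $$\mathcal E_0^{(s)}=-\sum_{s'\in\mathcal S}\rho_{s'}\Big(\psi\big(\tfrac{s'+s+1}2\big)-\psi\big(\tfrac{|s'-s|+1}2\big)\Big),\qquad \Delta E^{(s)}=\sum_{d=1}^{\mathcal D_s}\frac{\pi}{\cosh(\pi\tilde\lambda_{s,d})} .$$ Theorem. For fixed $s_1,\dots,s_{L_0}$, $(\mu_s)$ and $(\tilde\nu_r)$, the energy density of every Bethe state is, at order $1/L$, $$\frac{E^{(s)}}L=\mathcal E_0^{(s)}+\frac1L\,\Delta E^{(s)}+o\Big(\frac1L\Big)\qquad(s\in\mathcal S),$$ uniformly over all Bethe states of length $L$ in the given configuration as $L\to\infty$: only the holes in the sea of $2s$-strings contribute to $\Delta E^{(s)}$. Moreover, with the hole momentum $\mathfrak p^{(s)}(\lambda)=\rho_s\arctan(\sinh(\pi\lambda))+\frac{\rho_s\pi}2$, the dispersion law $$\Delta E^{(s)}=\pi\sum_{d=1}^{\mathcal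 D_s}\sin\Big(\frac{\mathfrak p^{(s)}(\tilde\lambda_{s,d})}{\rho_s}\Big)$$ holds. -/

import Mathlib

open scoped BigOperators

noncomputable section

namespace RegularSpinChain

/-! Half-integers are encoded by their doubles: the natural number `a ≥ 1` stands for the spin `a / 2`,
and also for the type `m = a / 2` of a `2m`-string, so that `a` is the length of the string. -/

/-- The elementary phase `φ_r(x) = 2 arctan (2 x / r)`, with `φ_0 = 0` (division by zero is zero). -/
def phi (r : ℕ) (x : ℝ) : ℝ := 2 * Real.arctan (2 * x / r)

/-- String-string phase `Φ_2^{(p,m)} = φ_{2p+2m} + φ_{2|p-m|} + 2 ∑_{α=|p-m|+1}^{p+m-1} φ_{2α}`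
for `a = 2p`, `b = 2m`; here `2α = |a-b| + 2 + 2i` with `0 ≤ i < min a b - 1`. -/
def PhiTwo (a b : ℕ) (x : ℝ) : ℝ :=
  phi (a + b) x + phi ((a : ℤ) - b).natAbs x
    + 2 * ∑ i ∈ Finset.range (min a b - 1), phi (((a : ℤ) - b).natAbs + 2 + 2 * i) x

/-- Site-string phase `Φ_p^{(m)} = ∑_{α=|p/2-m+1/2|+1}^{p/2+m-1/2} φ_{2α} + θ(p > 2m-1) φ_{p-2m+1}`
for `b = 2m`; here `2α = |p+1-b| + 2 + 2i` with `0 ≤ i < min p (b - 1)`. -/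
def PhiSite (p b : ℕ) (x : ℝ) : ℝ :=
  (∑ i ∈ Finset.range (min p (b - 1)), phi (((p : ℤ) + 1 - b).natAbs + 2 + 2 * i) x)
    + if b < p + 1 then phi (p + 1 - b) x else 0

/-- `Ψ_p^{(m)}`, the derivative of `Φ_p^{(m)}`. -/
def PsiSite (p b : ℕ) : ℝ → ℝ := deriv (PhiSite p b)

/-- The repeated motif of an `L₀`-regular chain: the doubled spins `2 s_1, …, 2 s_{L₀}`. -/
structure Motif where
  L₀ : ℕ
  L₀_pos : 0 < L₀
  twoSpin : Fin L₀ → ℕ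
  twoSpin_pos : ∀ i, 0 < twoSpin i

namespace Motif

variable (C : Motif)

/-- The set `𝒮` of the (doubled) values of the spins present in the chain. -/
def spins : Finset ℕ := Finset.univ.image C.twoSpin

/-- The density `ρ_s` of the spin `s = a / 2`. -/
def rho (a : ℕ) : ℝ := ((Finset.univ.filter fun i => C.twoSpin i = a).card : ℝ) / C.L₀

/-- The doubled spin at the site `j` of the chain (sites counted from `0`). -/
def siteSpin (j : ℕ) : ℕ := C.twoSpin ⟨j % C.L₀, Nat.mod_lt _ C.L₀_pos⟩

/-- The valence `P_m(ν) = 2 ∑_j min(m, s_j) - 4 ∑_n min(m, n) ν_n + ν_m`, `a = 2m`, of a configuration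
`ν` (`ν b` strings of length `b`) for the chain of length `L`. -/
def valence (L : ℕ) (ν : ℕ →₀ ℕ) (a : ℕ) : ℤ :=
  ∑ j ∈ Finset.range L, (min a (C.siteSpin j) : ℤ)
    - 2 * ∑ b ∈ ν.support, (min a b : ℤ) * ν b + ν a

/-- The allowed quantum numbers `(1-P)/2, (3-P)/2, …, (P-1)/2` for the strings of length `a`. -/
def allowed (L : ℕ) (ν : ℕ →₀ ℕ) (a : ℕ) : Set ℝ :=
  {q | ∃ i : ℕ, (i : ℤ) < C.valence L ν a ∧ q = (1 - (C.valence L ν a : ℝ)) / 2 + i}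

/-- The counting function `L ∑_s ρ_s Φ_{2s}^{(m)}(x) - ∑_p ∑_ℓ Φ_2^{(p,m)}(x - λ_{p,ℓ})`, `a = 2m`. -/
def counting (L : ℕ) (ν : ℕ →₀ ℕ) (center : (b : ℕ) → Fin (ν b) → ℝ) (a : ℕ) (x : ℝ) : ℝ :=
  L * ∑ s ∈ C.spins, C.rho s * PhiSite s a x
    - ∑ b ∈ ν.support, ∑ l : Fin (ν b), PhiTwo b a (x - center b l)

/-- The vacuum energy density
`ℰ_0^{(s)} = - ∑_{s'} ρ_{s'} (ψ((s'+s+1)/2) - ψ((|s'-s|+1)/2))`, `a = 2s`. -/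
def vacuumEnergy (a : ℕ) : ℝ :=
  - ∑ b ∈ C.spins, C.rho b *
      ((Complex.digamma ((((b : ℝ) / 2 + (a : ℝ) / 2 + 1) / 2 : ℝ) : ℂ)).re
        - (Complex.digamma (((|(b : ℝ) / 2 - (a : ℝ) / 2| + 1) / 2 : ℝ) : ℂ)).re)

/-- The momentum `𝔭^{(s)}(x) = ρ_s arctan (sinh (π x)) + ρ_s π / 2` of a hole of rapidity `x`, `a = 2s`. -/
def holeMomentum (a : ℕ) (x : ℝ) : ℝ :=
  C.rho a * Real.arctan (Real.sinh (Real.pi * x)) + C.rho a * Real.pi / 2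

end Motif

/-- The data, independent of the length, of an excited configuration: `μ_s = removed (2s)` for `s ∈ 𝒮`
(the values of `removed` outside `𝒮` play no role), and the numbers of the new strings, whose lengths
are positive and not of the form `2s`, `s ∈ 𝒮`. -/
structure Excitation (C : Motif) where
  removed : ℕ → ℤ
  newStrings : ℕ →₀ ℕ
  newStrings_pos : newStrings 0 = 0
  newStrings_spins : ∀ a ∈ C.spins, newStrings a = 0

/-- A Bethe state (under the string hypothesis) of the chain of length `L` in a given excited
configuration. -/
structure BetheState (C : Motif) (X : Excitation C) (L : ℕ) where
  dvd : C.L₀ ∣ L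
  /-- number of strings of each length: `L ρ_s / 2 - μ_s` in the seas, and the new strings -/
  ν : ℕ →₀ ℕ
  ν_sea : ∀ a ∈ C.spins, (ν a : ℝ) = L * C.rho a / 2 - X.removed a
  ν_new : ∀ a ∉ C.spins, ν a = X.newStrings a
  /-- the real centers of the strings -/
  center : (a : ℕ) → Fin (ν a) → ℝ
  /-- the quantum numbers of the strings -/
  Q : (a : ℕ) → Fin (ν a) → ℝ
  Q_allowed : ∀ a k, Q a k ∈ C.allowed L ν a
  Q_injective : ∀ a, Function.Injective (Q a)
  /-- the logarithmic Bethe equations for the centers -/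
  bethe : ∀ a k, C.counting L ν center a (center a k) = 2 * Real.pi * Q a k
  /-- the unused quantum numbers in the seas, `𝒟_s = P_s - ν_s` in number -/
  holeQ : (a : ℕ) → Fin (C.valence L ν a - ν a).toNat → ℝ
  holeQ_injective : ∀ a ∈ C.spins, Function.Injective (holeQ a)
  holeQ_range : ∀ a ∈ C.spins, Set.range (holeQ a) = C.allowed L ν a \ Set.range (Q a)
  /-- the rapidities of the holes -/
  hole : (a : ℕ) → Fin (C.valence L ν a - ν a).toNat → ℝ
  hole_eq : ∀ a ∈ C.spins, ∀ d, C.counting L ν center a (hole a d) = 2 * Real.pi * holeQ a d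
  /-- in the seas, a quantum number `(1 - P_s)/2 + i` determines the root (or hole) -/
  unique : ∀ a ∈ C.spins, ∀ i : ℤ, ∀ x y : ℝ,
    C.counting L ν center a x = 2 * Real.pi * ((1 - (C.valence L ν a : ℝ)) / 2 + i) →
    C.counting L ν center a y = 2 * Real.pi * ((1 - (C.valence L ν a : ℝ)) / 2 + i) → x = y

namespace BetheState

variable {C : Motif} {X : Excitation C} {L : ℕ}

/-- The number `𝒟_s` of holes in the sea of strings of length `a = 2s`. -/
abbrev numHoles (B : BetheState C X L) (a : ℕ) : ℕ := (C.valence L B.ν a - B.ν a).toNat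

/-- The energy `E^{(s)} = - ∑_m ∑_k Ψ_{2s}^{(m)}(λ_{m,k})`, `a = 2s`. -/
def energy (B : BetheState C X L) (a : ℕ) : ℝ :=
  - ∑ b ∈ B.ν.support, ∑ k : Fin (B.ν b), PsiSite a b (B.center b k)

/-- `ΔE^{(s)} = ∑_d π / cosh (π λ̃_{s,d})`, `a = 2s`. -/
def excitationEnergy (B : BetheState C X L) (a : ℕ) : ℝ :=
  ∑ d : Fin (B.numHoles a), Real.pi / Real.cosh (Real.pi * B.hole a d)

end BetheState

end RegularSpinChain

end

noncomputable section

namespace RegularSpinChain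

open MeasureTheory Filter Topology Real FourierTransform Convolution

/-! Write s(x) = 1/(2 cosh πx) (`halfSech`), and divide all phase derivatives by 2π. The Cauchy
kernel of index n has Fourier transform e^{-nπ|ξ|}, and s is its own transform; so 2 cosh(πξ)
e^{-nπ|ξ|} = e^{-(n-1)π|ξ|} + e^{-(n+1)π|ξ|} becomes a convolution identity, and summing it gives
`KSite_eq_conv`: the energy kernel of a string of length b for the spin a is δ_ab s plus s convolved
with the string-string kernel.

Summed over all strings, the convolution part is the integral of s against the site term of the
counting function minus its derivative; the site term produces the vacuum energy, whose digamma
values come from ∫ s·`KSite`. Let u be the counting function of the sea a, normalised so that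
centers and holes sit at the values 1/2, ..., P - 1/2, and let r be u minus the number of centers
and holes to the left. Integration by parts turns the sum of s over centers and holes into ∫ s u' +
∫ s' r. Everything then collapses to an exact identity, `energy_sub_eq`: energy minus vacuum and
hole terms equals -2π ∫ s' r. New strings and holes of other seas drop out exactly.

It remains to see that ∫ s' r tends to 0. The uniqueness of roots gives |r| ≤ 1/2 without any
monotonicity of u. Moreover r is a sawtooth in u, so r u' is half the derivative of the continuous
function r², and ∫ g r u' = -(1/2) ∫ g' r² stays bounded although u' is of order L. If u'/L tends to
ρ s, it follows that ∫ g r s tends to 0; the choice g ≈ s'/s gives the claim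
(`tendsto_integral_deriv_halfSech_mul`).

The convergence of u'/L is obtained by compactness (`exists_subseq_tendsto_density`). The densities
are equibounded and equi-Lipschitz and solve the linear integral equations up to O(1/L). A limit
point is nonnegative and integrable, because the increments of u lie between -1 and P + 1, and it
solves the limiting system, whose symbol is positive definite; hence it is ρ s. Uniformity over
states is built in, since the compactness is applied to a sequence of supposed counterexamples. -/

/-- Continuously differentiable, and bounded and integrable together with the derivative. -/
structure Tame (f : ℝ → ℝ) : Prop where
  contDiff : ContDiff ℝ 1 f
  integrable : Integrable f
  integrable_deriv : Integrable (deriv f)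
  bdd : ∃ C, ∀ x, |f x| ≤ C
  bdd_deriv : ∃ C, ∀ x, |deriv f x| ≤ C

/-! ### Calculus of tame functions -/

namespace Tame

variable {f g : ℝ → ℝ}

theorem continuous (hf : Tame f) : Continuous f := hf.contDiff.continuous

theorem differentiable (hf : Tame f) : Differentiable ℝ f := hf.contDiff.differentiable one_ne_zero

theorem hasDerivAt (hf : Tame f) (x : ℝ) : HasDerivAt f (deriv f x) x :=
  (hf.differentiable x).hasDerivAt

theorem continuous_deriv (hf : Tame f) : Continuous (deriv f) :=
  hf.contDiff.continuous_deriv le_rfl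

theorem zero : Tame fun _ => 0 where
  contDiff := contDiff_const
  integrable := integrable_zero _ _ _
  integrable_deriv := by simp
  bdd := ⟨0, by simp⟩
  bdd_deriv := ⟨0, by simp⟩

theorem add (hf : Tame f) (hg : Tame g) : Tame fun x => f x + g x := by
  have hd : deriv (fun x => f x + g x) = fun x => deriv f x + deriv g x := by
    funext x; exact deriv_fun_add (hf.differentiable x) (hg.differentiable x)
  refine ⟨hf.contDiff.add hg.contDiff, hf.integrable.add hg.integrable, ?_, ?_, ?_⟩
  · rw [hd]; exact hf.integrable_deriv.add hg.integrable_deriv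
  · obtain ⟨C, hC⟩ := hf.bdd
    obtain ⟨D, hD⟩ := hg.bdd
    exact ⟨C + D, fun x => (abs_add_le _ _).trans (add_le_add (hC x) (hD x))⟩
  · rw [hd]
    obtain ⟨C, hC⟩ := hf.bdd_deriv
    obtain ⟨D, hD⟩ := hg.bdd_deriv
    exact ⟨C + D, fun x => (abs_add_le _ _).trans (add_le_add (hC x) (hD x))⟩

theorem sum {ι : Type*} (s : Finset ι) {f : ι → ℝ → ℝ} (hf : ∀ i ∈ s, Tame (f i)) :
    Tame fun x => ∑ i ∈ s, f i x := by
  classical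
  induction s using Finset.induction_on with
  | empty => simpa using zero
  | insert a s ha ih =>
    simp only [Finset.sum_insert ha]
    exact (hf a (by simp)).add (ih fun i hi => hf i (by simp [hi]))

/-- The product of a tame function with a bounded function of bounded derivative is tame. -/
theorem mul_bdd (hf : Tame f) (hg : ContDiff ℝ 1 g) {C D : ℝ} (hC : ∀ x, |g x| ≤ C)
    (hD : ∀ x, |deriv g x| ≤ D) : Tame fun x => f x * g x := by
  have hgd : Differentiable ℝ g := hg.differentiable one_ne_zero
  have hd : deriv (fun x => f x * g x) = fun x => deriv f x * g x + f x * deriv g x := by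
    funext x; exact deriv_fun_mul (hf.differentiable x) (hgd x)
  have hC0 : 0 ≤ C := (abs_nonneg _).trans (hC 0)
  have hD0 : 0 ≤ D := (abs_nonneg _).trans (hD 0)
  refine ⟨hf.contDiff.mul hg, ?_, ?_, ?_, ?_⟩
  · exact hf.integrable.mul_bdd hg.continuous.aestronglyMeasurable (Eventually.of_forall hC)
  · rw [hd]
    exact (hf.integrable_deriv.mul_bdd hg.continuous.aestronglyMeasurable
      (Eventually.of_forall hC)).add (hf.integrable.mul_bdd
      (hg.continuous_deriv le_rfl).aestronglyMeasurable (Eventually.of_forall hD))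
  · obtain ⟨A, hA⟩ := hf.bdd
    refine ⟨A * C, fun x => ?_⟩
    rw [abs_mul]
    exact mul_le_mul (hA x) (hC x) (abs_nonneg _) ((abs_nonneg _).trans (hA 0))
  · rw [hd]
    obtain ⟨A, hA⟩ := hf.bdd
    obtain ⟨B, hB⟩ := hf.bdd_deriv
    refine ⟨B * C + A * D, fun x => (abs_add_le _ _).trans ?_⟩
    rw [abs_mul, abs_mul]
    exact add_le_add (mul_le_mul (hB x) (hC x) (abs_nonneg _) ((abs_nonneg _).trans (hB 0)))
      (mul_le_mul (hA x) (hD x) (abs_nonneg _) ((abs_nonneg _).trans (hA 0)))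

/-- Reflected translates of tame functions are tame. -/
theorem comp_sub_left (hf : Tame f) (t : ℝ) : Tame fun x => f (t - x) := by
  have hd : deriv (fun x => f (t - x)) = fun x => -deriv f (t - x) := by
    funext x; exact deriv_comp_const_sub (f := f) (a := t) (x := x)
  refine ⟨hf.contDiff.comp (contDiff_const.sub contDiff_id), hf.integrable.comp_sub_left t, ?_, ?_,
    ?_⟩
  · rw [hd]; exact (hf.integrable_deriv.comp_sub_left t).neg
  · obtain ⟨C, hC⟩ := hf.bdd
    exact ⟨C, fun x => hC _⟩
  · rw [hd]
    obtain ⟨C, hC⟩ := hf.bdd_deriv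
    exact ⟨C, fun x => by rw [abs_neg]; exact hC _⟩

theorem integral_abs_deriv_comp_sub_left (f : ℝ → ℝ) (t : ℝ) :
    ∫ x, |deriv (fun y => f (t - y)) x| = ∫ x, |deriv f x| := by
  have hd : deriv (fun x => f (t - x)) = fun x => -deriv f (t - x) := by
    funext x; exact deriv_comp_const_sub (f := f) (a := t) (x := x)
  rw [hd]
  simp only [abs_neg]
  exact integral_sub_left_eq_self (fun x => |deriv f x|) volume t

theorem lipschitz (hf : Tame f) : ∃ C, 0 ≤ C ∧ ∀ x y, |f x - f y| ≤ C * |x - y| := by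
  obtain ⟨C, hC⟩ := hf.bdd_deriv
  refine ⟨C, (abs_nonneg _).trans (hC 0), fun x y => ?_⟩
  have := Convex.norm_image_sub_le_of_norm_deriv_le (s := Set.univ) (f := f) (C := C)
    (fun z _ => hf.differentiable z) (fun z _ => hC z) convex_univ (Set.mem_univ y)
    (Set.mem_univ x)
  simpa using this

theorem tendsto_atTop (hf : Tame f) : Tendsto f atTop (𝓝 0) :=
  tendsto_zero_of_hasDerivAt_of_integrableOn_Ioi (a := 0) (fun x _ => hf.hasDerivAt x)
    hf.integrable_deriv.integrableOn hf.integrable.integrableOn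

theorem tendsto_atBot (hf : Tame f) : Tendsto f atBot (𝓝 0) :=
  tendsto_zero_of_hasDerivAt_of_integrableOn_Iic (a := 0) (fun x _ => hf.hasDerivAt x)
    hf.integrable_deriv.integrableOn hf.integrable.integrableOn

end Tame

/-! ### The Cauchy kernels -/

/-- The Cauchy density `φ_n' / (2π)`; it vanishes for `n = 0`. -/
def kap (n : ℕ) (x : ℝ) : ℝ := 2 / π * (n / ((n : ℝ) ^ 2 + 4 * x ^ 2))

@[simp] theorem kap_zero (x : ℝ) : kap 0 x = 0 := by simp [kap]

theorem kap_neg (n : ℕ) (x : ℝ) : kap n (-x) = kap n x := by simp [kap]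

theorem kap_nonneg (n : ℕ) (x : ℝ) : 0 ≤ kap n x := by unfold kap; positivity

theorem kap_le (n : ℕ) (hn : 1 ≤ n) (x : ℝ) : kap n x ≤ 2 / π * (1 / n) := by
  have h : (0 : ℝ) < n := by exact_mod_cast hn
  unfold kap
  refine mul_le_mul_of_nonneg_left ?_ (by positivity)
  rw [div_le_div_iff₀ (by positivity) h]
  nlinarith [sq_nonneg x]

theorem hasDerivAt_phi (n : ℕ) (x : ℝ) : HasDerivAt (phi n) (2 * π * kap n x) x := by
  rcases Nat.eq_zero_or_pos n with rfl | hn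
  · have : phi 0 = fun _ => 0 := by funext y; simp [phi]
    rw [this]; simpa using hasDerivAt_const x (0 : ℝ)
  · have h : (0 : ℝ) < n := by exact_mod_cast hn
    have h1 : HasDerivAt (fun y : ℝ => 2 * y / (n : ℝ)) (2 / n) x := by
      simpa using ((hasDerivAt_id x).const_mul 2).div_const (n : ℝ)
    have h2 := (h1.arctan).const_mul 2
    refine h2.congr_deriv ?_
    unfold kap
    have := pi_pos
    field_simp
    ring

theorem phi_tendsto_atTop {n : ℕ} (hn : 0 < n) : Tendsto (phi n) atTop (𝓝 π) := by
  have h : (0 : ℝ) < n := by exact_mod_cast hn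
  have h1 : Tendsto (fun x : ℝ => 2 * x / (n : ℝ)) atTop atTop :=
    (tendsto_id.const_mul_atTop (by norm_num)).atTop_div_const h
  have h2 := ((tendsto_nhds_of_tendsto_nhdsWithin tendsto_arctan_atTop).comp h1).const_mul 2
  rw [mul_div_cancel₀ _ two_ne_zero] at h2
  exact h2

theorem phi_neg (n : ℕ) (x : ℝ) : phi n (-x) = -phi n x := by
  simp [phi, neg_div, arctan_neg]

theorem hasDerivAt_kap (n : ℕ) (x : ℝ) :
    HasDerivAt (kap n) (-(2 / π * (8 * n * x / ((n : ℝ) ^ 2 + 4 * x ^ 2) ^ 2))) x := by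
  rcases Nat.eq_zero_or_pos n with rfl | hn
  · have : kap 0 = fun _ => 0 := by funext y; simp
    rw [this]; simpa using hasDerivAt_const x (0 : ℝ)
  · have h : (0 : ℝ) < n := by exact_mod_cast hn
    have h1 : HasDerivAt (fun y : ℝ => (n : ℝ) ^ 2 + 4 * y ^ 2) (4 * (2 * x)) x := by
      simpa using ((hasDerivAt_pow 2 x).const_mul 4).const_add ((n : ℝ) ^ 2)
    have h2 := ((hasDerivAt_const x (n : ℝ)).div h1 (by positivity)).const_mul (2 / π)
    refine h2.congr_deriv ?_
    ring

theorem tame_kap (n : ℕ) : Tame (kap n) := by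
  rcases Nat.eq_zero_or_pos n with rfl | hn
  · have : kap 0 = fun _ => 0 := by funext y; simp
    rw [this]; exact Tame.zero
  have h : (1 : ℝ) ≤ n := by exact_mod_cast hn
  have hint : Integrable (kap n) := by
    refine (integrable_inv_one_add_sq.const_mul (2 / π * n)).mono' ?_ (Eventually.of_forall ?_)
    · refine Continuous.aestronglyMeasurable (continuous_iff_continuousAt.2 fun x =>
        (hasDerivAt_kap n x).continuousAt)
    · intro x
      rw [norm_eq_abs, abs_of_nonneg (kap_nonneg n x)]
      unfold kap
      rw [mul_assoc, div_eq_mul_inv (n : ℝ)]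
      gcongr
      · nlinarith
      · nlinarith [sq_nonneg x]
  have hd : deriv (kap n) = fun x => -(2 / π * (8 * n * x / ((n : ℝ) ^ 2 + 4 * x ^ 2) ^ 2)) :=
    funext fun x => (hasDerivAt_kap n x).deriv
  have hb : ∀ x, |deriv (kap n) x| ≤ 2 * kap n x := by
    intro x
    rw [hd]
    unfold kap
    have hp : (0 : ℝ) < (n : ℝ) ^ 2 + 4 * x ^ 2 := by positivity
    rw [abs_neg, abs_mul, abs_of_nonneg (by positivity : 0 ≤ 2 / π), abs_div,
      abs_of_nonneg (by positivity : 0 ≤ ((n : ℝ) ^ 2 + 4 * x ^ 2) ^ 2), mul_left_comm]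
    gcongr
    rw [← mul_div_assoc, div_le_div_iff₀ (by positivity) hp, abs_mul,
      abs_of_nonneg (by positivity : (0 : ℝ) ≤ 8 * n)]
    -- This is (2|x| - 1)² ≥ 0 together with n ≥ 1.
    have : 4 * |x| ≤ (n : ℝ) ^ 2 + 4 * x ^ 2 := by
      rw [← sq_abs x]; nlinarith [sq_nonneg (2 * |x| - 1)]
    calc 8 * (n : ℝ) * |x| * ((n : ℝ) ^ 2 + 4 * x ^ 2)
        = 2 * n * (4 * |x|) * ((n : ℝ) ^ 2 + 4 * x ^ 2) := by ring
      _ ≤ 2 * n * ((n : ℝ) ^ 2 + 4 * x ^ 2) * ((n : ℝ) ^ 2 + 4 * x ^ 2) := by gcongr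
      _ = _ := by ring
  have hc : ContDiff ℝ 1 (kap n) := by
    unfold kap
    exact contDiff_const.mul (contDiff_const.div (by fun_prop) fun x => by positivity)
  refine ⟨hc, hint, ?_, ⟨2 / π * (1 / n), fun x => ?_⟩, ⟨2 * (2 / π * (1 / n)), fun x => ?_⟩⟩
  · exact (hint.const_mul 2).mono' (hc.continuous_deriv le_rfl).aestronglyMeasurable
      (Eventually.of_forall hb)
  · rw [abs_of_nonneg (kap_nonneg n x)]; exact kap_le n hn x
  · exact (hb x).trans (by linarith [kap_le n hn x])

/-- The site-string kernel `Φ_a^{(b)}' / (2π)`. -/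
def KSite (a b : ℕ) (x : ℝ) : ℝ :=
  ∑ i ∈ Finset.range (min a b), kap (((a : ℤ) - b).natAbs + 2 * i + 1) x

/-- The string-string kernel `Φ_2^{(a,b)}' / (2π)`. -/
def KTwo (a b : ℕ) (x : ℝ) : ℝ :=
  ∑ i ∈ Finset.range (min a b),
    (kap (((a : ℤ) - b).natAbs + 2 * i) x + kap (((a : ℤ) - b).natAbs + 2 * i + 2) x)

theorem KTwo_comm (a b : ℕ) : KTwo a b = KTwo b a := by
  have : ((a : ℤ) - b).natAbs = ((b : ℤ) - a).natAbs := by omega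
  unfold KTwo
  rw [min_comm, this]

theorem KTwo_neg (a b : ℕ) (x : ℝ) : KTwo a b (-x) = KTwo a b x := by simp [KTwo, kap_neg]

theorem tame_KSite (a b : ℕ) : Tame (KSite a b) := Tame.sum _ fun _ _ => tame_kap _

theorem tame_KTwo (a b : ℕ) : Tame (KTwo a b) :=
  Tame.sum _ fun _ _ => (tame_kap _).add (tame_kap _)

/-- The θ-term is the lowest term of the progression |a-b|+1, |a-b|+3, ..., a+b-1: it is separate
when b ≤ a and already in the sum when b > a. The uniform shape makes the kernel symmetric and
summable without cases. -/
theorem PhiSite_eq {a b : ℕ} (hb : 1 ≤ b) (x : ℝ) :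
    PhiSite a b x = ∑ i ∈ Finset.range (min a b), phi (((a : ℤ) - b).natAbs + 2 * i + 1) x := by
  unfold PhiSite
  split_ifs with h
  · obtain ⟨c, rfl⟩ : ∃ c, b = c + 1 := ⟨b - 1, by omega⟩
    rw [show min a (c + 1 - 1) = c by omega, show min a (c + 1) = c + 1 by omega,
      Finset.sum_range_succ']
    congr 1
    · refine Finset.sum_congr rfl fun i _ => ?_
      congr 1
      omega
    · congr 1
      omega
  · rw [show min a (b - 1) = min a b by omega, add_zero]
    refine Finset.sum_congr rfl fun i _ => ?_
    congr 1
    omega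

/-- The indices |a-b|, |a-b|+2, ..., a+b are grouped into consecutive pairs; interior ones lie in
two pairs, which explains the factor 2. Each pair surrounds one index of the site-string phase, as
the convolution identity requires. -/
theorem PhiTwo_eq {a b : ℕ} (ha : 1 ≤ a) (hb : 1 ≤ b) (x : ℝ) :
    PhiTwo a b x = ∑ i ∈ Finset.range (min a b),
      (phi (((a : ℤ) - b).natAbs + 2 * i) x + phi (((a : ℤ) - b).natAbs + 2 * i + 2) x) := by
  unfold PhiTwo
  obtain ⟨c, hc⟩ : ∃ c, min a b = c + 1 := ⟨min a b - 1, by omega⟩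
  have hab : a + b = ((a : ℤ) - b).natAbs + 2 * c + 2 := by omega
  rw [hc, hab, Finset.sum_add_distrib, Finset.sum_range_succ', Finset.sum_range_succ]
  simp only [Nat.add_sub_cancel]
  have h1 : ∀ i : ℕ, ((a : ℤ) - b).natAbs + 2 * (i + 1) = ((a : ℤ) - b).natAbs + 2 + 2 * i := by
    intro i; omega
  have h2 : ∀ i : ℕ, ((a : ℤ) - b).natAbs + 2 * i + 2 = ((a : ℤ) - b).natAbs + 2 + 2 * i := by
    intro i; omega
  simp only [h1, h2, mul_zero, add_zero]
  ring

theorem hasDerivAt_PhiSite {a b : ℕ} (hb : 1 ≤ b) (x : ℝ) :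
    HasDerivAt (PhiSite a b) (2 * π * KSite a b x) x := by
  rw [funext (PhiSite_eq (a := a) hb), KSite, Finset.mul_sum]
  exact HasDerivAt.fun_sum fun i _ => hasDerivAt_phi _ x

theorem hasDerivAt_PhiTwo {a b : ℕ} (ha : 1 ≤ a) (hb : 1 ≤ b) (x : ℝ) :
    HasDerivAt (PhiTwo a b) (2 * π * KTwo a b x) x := by
  rw [funext (PhiTwo_eq ha hb), KTwo, Finset.mul_sum]
  refine HasDerivAt.fun_sum fun i _ => ?_
  rw [mul_add]
  exact (hasDerivAt_phi _ x).add (hasDerivAt_phi _ x)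

theorem PsiSite_eq {a b : ℕ} (hb : 1 ≤ b) (x : ℝ) : PsiSite a b x = 2 * π * KSite a b x :=
  (hasDerivAt_PhiSite hb x).deriv

theorem PhiSite_neg (a b : ℕ) (x : ℝ) : PhiSite a b (-x) = -PhiSite a b x := by
  unfold PhiSite
  simp only [phi_neg, Finset.sum_neg_distrib]
  split_ifs <;> ring

theorem PhiTwo_neg (a b : ℕ) (x : ℝ) : PhiTwo a b (-x) = -PhiTwo a b x := by
  unfold PhiTwo
  simp only [phi_neg, Finset.sum_neg_distrib]
  ring

theorem PhiSite_tendsto_atTop {a b : ℕ} (hb : 1 ≤ b) :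
    Tendsto (PhiSite a b) atTop (𝓝 (π * (min a b : ℕ))) := by
  rw [funext (PhiSite_eq (a := a) hb)]
  have := tendsto_finsetSum (Finset.range (min a b)) fun i (_ : i ∈ _) =>
    phi_tendsto_atTop (n := ((a : ℤ) - b).natAbs + 2 * i + 1) (by omega)
  simpa [mul_comm] using this

/-- For a = b the bottom index is 0, and φ_0 = 0 contributes nothing instead of π. This deficit is
the origin of the summand ν_m in the valence. -/
theorem PhiTwo_tendsto_atTop {a b : ℕ} (ha : 1 ≤ a) (hb : 1 ≤ b) :
    Tendsto (PhiTwo a b) atTop (𝓝 (π * (2 * (min a b : ℕ) - if a = b then 1 else 0))) := by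
  rw [funext (PhiTwo_eq ha hb)]
  obtain ⟨c, hc⟩ : ∃ c, min a b = c + 1 := ⟨min a b - 1, by omega⟩
  have h0 : ∀ i : ℕ, Tendsto (phi (((a : ℤ) - b).natAbs + 2 * (i + 1))) atTop (𝓝 π) := fun i =>
    phi_tendsto_atTop (by omega)
  have h1 : ∀ i : ℕ, Tendsto (phi (((a : ℤ) - b).natAbs + 2 * i + 2)) atTop (𝓝 π) := fun i =>
    phi_tendsto_atTop (by omega)
  have h2 : Tendsto (phi (((a : ℤ) - b).natAbs + 2 * 0)) atTop (𝓝 (π - if a = b then π else 0)) := by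
    split_ifs with h
    · subst h
      have : phi (((a : ℤ) - a).natAbs + 2 * 0) = fun _ => 0 := by funext y; simp [phi]
      rw [this]; simp
    · simpa using phi_tendsto_atTop (n := ((a : ℤ) - b).natAbs + 2 * 0) (by omega)
  simp only [Finset.sum_add_distrib, hc]
  simp only [Finset.sum_range_succ' _ c]
  have := ((tendsto_finsetSum (Finset.range c) fun i _ => h0 i).add h2).add
    ((tendsto_finsetSum (Finset.range c) fun i _ => h1 (i + 1)).add (h1 0))
  convert this using 2
  simp
  split_ifs <;> ring

/-! ### The hyperbolic secant -/

/-- The kernel `1 / (2 cosh (π x))`. -/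
def halfSech (x : ℝ) : ℝ := 1 / (2 * cosh (π * x))

theorem halfSech_pos (x : ℝ) : 0 < halfSech x := by
  unfold halfSech; have := cosh_pos (π * x); positivity

theorem halfSech_le (x : ℝ) : halfSech x ≤ 1 / 2 := by
  unfold halfSech
  have := one_le_cosh (π * x)
  rw [div_le_div_iff₀ (by positivity) (by norm_num)]
  linarith

theorem hasDerivAt_halfSech (x : ℝ) :
    HasDerivAt halfSech (-(π * tanh (π * x)) * halfSech x) x := by
  have h1 : HasDerivAt (fun y : ℝ => π * y) π x := by simpa using (hasDerivAt_id x).const_mul π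
  have h := (hasDerivAt_const x (1 : ℝ)).div (h1.cosh.const_mul 2) (by have := cosh_pos (π * x); positivity)
  refine h.congr_deriv ?_
  have := cosh_pos (π * x)
  unfold halfSech
  rw [tanh_eq_sinh_div_cosh]
  field_simp
  ring

theorem hasDerivAt_tanh_pi (x : ℝ) :
    HasDerivAt (fun y => tanh (π * y)) (4 * π * halfSech x ^ 2) x := by
  have h1 : HasDerivAt (fun y : ℝ => π * y) π x := by simpa using (hasDerivAt_id x).const_mul π
  have h := h1.sinh.div h1.cosh (cosh_pos (π * x)).ne'
  simp only [tanh_eq_sinh_div_cosh]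
  refine h.congr_deriv ?_
  have h2 := cosh_pos (π * x)
  have h3 := cosh_sq (π * x)
  unfold halfSech
  field_simp
  linear_combination (4 : ℝ) * h3

theorem abs_tanh_le (x : ℝ) : |tanh x| ≤ 1 := (abs_tanh_lt_one x).le

theorem deriv_halfSech : deriv halfSech = fun x => -(π * tanh (π * x)) * halfSech x :=
  funext fun x => (hasDerivAt_halfSech x).deriv

theorem contDiff_halfSech (n : ℕ∞) : ContDiff ℝ n halfSech := by
  unfold halfSech
  refine contDiff_const.div (contDiff_const.mul (contDiff_cosh.comp (contDiff_const.mul contDiff_id)))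
    fun x => ?_
  have := cosh_pos (π * x)
  positivity

theorem abs_deriv_halfSech_le (x : ℝ) : |deriv halfSech x| ≤ π * halfSech x := by
  rw [deriv_halfSech, abs_mul, abs_neg, abs_mul, abs_of_pos pi_pos, abs_of_pos (halfSech_pos x)]
  gcongr
  · exact (halfSech_pos x).le
  · nlinarith [abs_tanh_le (π * x), pi_pos]

theorem integrable_halfSech : Integrable halfSech := by
  refine (integrable_inv_one_add_sq).mono' (contDiff_halfSech 0).continuous.aestronglyMeasurable
    (Eventually.of_forall fun x => ?_)
  rw [norm_eq_abs, abs_of_pos (halfSech_pos x)]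
  unfold halfSech
  rw [one_div]
  gcongr
  -- The comparison with 1 + x² comes from 2 cosh y ≥ e^{|y|} ≥ 1 + |y| + y²/2 at y = πx, with π² ≥
  -- 9.
  have h1 := quadratic_le_exp_of_nonneg (abs_nonneg (π * x))
  rw [← cosh_abs, cosh_eq]
  have h2 := exp_pos (-|π * x|)
  rw [sq_abs] at h1
  have h3 : (3 : ℝ) ^ 2 ≤ π ^ 2 := by gcongr; exact pi_gt_three.le
  nlinarith [abs_nonneg (π * x), mul_le_mul_of_nonneg_right h3 (sq_nonneg x)]

theorem tame_halfSech : Tame halfSech := by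
  refine ⟨contDiff_halfSech 1, integrable_halfSech, ?_, ⟨1 / 2, fun x => ?_⟩,
    ⟨π * (1 / 2), fun x => ?_⟩⟩
  · exact (integrable_halfSech.const_mul π).mono'
      ((contDiff_halfSech 1).continuous_deriv le_rfl).aestronglyMeasurable
      (Eventually.of_forall abs_deriv_halfSech_le)
  · rw [abs_of_pos (halfSech_pos x)]; exact halfSech_le x
  · exact (abs_deriv_halfSech_le x).trans
      (mul_le_mul_of_nonneg_left (halfSech_le x) pi_pos.le)

theorem tame_deriv_halfSech : Tame (deriv halfSech) := by
  have hd : ∀ x, HasDerivAt (fun x => -(π * tanh (π * x))) (-(π * (4 * π * halfSech x ^ 2))) x :=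
    fun x => ((hasDerivAt_tanh_pi x).const_mul π).neg
  have hc : ContDiff ℝ 1 fun x => -(π * tanh (π * x)) := by
    rw [contDiff_one_iff_deriv]
    refine ⟨fun x => (hd x).differentiableAt, ?_⟩
    rw [funext fun x => (hd x).deriv]
    have := (contDiff_halfSech 0).continuous
    fun_prop
  have := tame_halfSech.mul_bdd hc (C := π) (D := π * (4 * π * (1 / 2) ^ 2)) (fun x => ?_)
    fun x => ?_
  · rw [deriv_halfSech]
    simpa only [mul_comm] using this
  · rw [abs_neg, abs_mul, abs_of_pos pi_pos]
    nlinarith [abs_tanh_le (π * x), pi_pos]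
  · have h0 := (halfSech_pos x).le
    have hp := pi_pos
    rw [(hd x).deriv, abs_neg, abs_of_nonneg (by positivity)]
    gcongr
    exact halfSech_le x

/-! ### Fourier transforms -/

/-- The Fourier transform of a real function. -/
def ft (f : ℝ → ℝ) (ξ : ℝ) : ℂ := 𝓕 (fun x => (f x : ℂ)) ξ

/-- The convolution of two real functions. -/
def conv (f g : ℝ → ℝ) (x : ℝ) : ℝ := ∫ y, f y * g (x - y)

theorem ofReal_conv (f g : ℝ → ℝ) :
    (fun x => (conv f g x : ℂ)) =
      (fun x => (f x : ℂ)) ⋆[ContinuousLinearMap.mul ℂ ℂ] fun x => (g x : ℂ) := by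
  funext x
  rw [convolution_def, conv, ← integral_complex_ofReal]
  simp

theorem ft_conv {f g : ℝ → ℝ} (hf : Integrable f) (hg : Integrable g) (ξ : ℝ) :
    ft (conv f g) ξ = ft f ξ * ft g ξ := by
  rw [ft, ofReal_conv]
  exact Real.fourier_mul_convolution_eq hf.ofReal hg.ofReal ξ

theorem integrable_conv {f g : ℝ → ℝ} (hf : Integrable f) (hg : Integrable g) :
    Integrable (conv f g) :=
  hf.integrable_convolution (ContinuousLinearMap.mul ℝ ℝ) hg

theorem continuous_conv {f g : ℝ → ℝ} (hf : Integrable f) (hg : Continuous g)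
    (hb : ∃ C, ∀ x, |g x| ≤ C) : Continuous (conv f g) := by
  obtain ⟨C, hC⟩ := hb
  exact BddAbove.continuous_convolution_right_of_integrable (ContinuousLinearMap.mul ℝ ℝ)
    ⟨C, by rintro _ ⟨x, rfl⟩; exact hC x⟩ hf hg

theorem ft_add {f g : ℝ → ℝ} (hf : Integrable f) (hg : Integrable g) (ξ : ℝ) :
    ft (fun x => f x + g x) ξ = ft f ξ + ft g ξ := by
  simp only [ft, Real.fourier_real_eq, Complex.ofReal_add, smul_add]
  refine integral_add ?_ ?_
  · simpa [mul_comm] using (Real.fourierIntegral_convergent_iff ξ).2 (hf.ofReal (𝕜 := ℂ))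
  · simpa [mul_comm] using (Real.fourierIntegral_convergent_iff ξ).2 (hg.ofReal (𝕜 := ℂ))

theorem ft_const_mul (c : ℝ) (f : ℝ → ℝ) (ξ : ℝ) : ft (fun x => c * f x) ξ = c * ft f ξ := by
  unfold ft
  rw [Real.fourier_real_eq_integral_exp_smul, Real.fourier_real_eq_integral_exp_smul,
    ← integral_const_mul]
  congr 1
  funext v
  simp only [Complex.ofReal_mul, smul_eq_mul]
  ring

@[simp] theorem ft_zero (ξ : ℝ) : ft (fun _ => 0) ξ = 0 := by
  simp [ft, Real.fourier_real_eq_integral_exp_smul]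

theorem ft_sum {ι : Type*} (s : Finset ι) {f : ι → ℝ → ℝ} (hf : ∀ i ∈ s, Integrable (f i)) (ξ : ℝ) :
    ft (fun x => ∑ i ∈ s, f i x) ξ = ∑ i ∈ s, ft (f i) ξ := by
  classical
  induction s using Finset.induction_on with
  | empty => simp
  | insert a s ha ih =>
    simp only [Finset.sum_insert ha]
    rw [ft_add (hf a (by simp)) (integrable_finsetSum _ fun i hi => hf i (by simp [hi])),
      ih fun i hi => hf i (by simp [hi])]

theorem eq_zero_of_ft_eq_zero {f : ℝ → ℝ} (hf : Continuous f) (hi : Integrable f)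
    (h : ∀ ξ, ft f ξ = 0) (x : ℝ) : f x = 0 := by
  have h0 : 𝓕 (fun x => (f x : ℂ)) = fun _ => 0 := funext h
  have h1 := congrFun ((Complex.continuous_ofReal.comp hf).fourierInv_fourier_eq hi.ofReal
    (by rw [Function.comp_def, h0]; exact integrable_zero _ _ _)) x
  rw [Function.comp_def, h0] at h1
  simpa [Real.fourierInv_eq', eq_comm] using h1

theorem eq_of_ft_eq {f g : ℝ → ℝ} (hf : Continuous f) (hi : Integrable f) (hg : Continuous g)
    (hj : Integrable g) (h : ∀ ξ, ft f ξ = ft g ξ) (x : ℝ) : f x = g x := by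
  have := eq_zero_of_ft_eq_zero (f := fun x => f x + (-1) * g x) (by fun_prop)
    (hi.add (hj.const_mul _)) (fun ξ => by
      rw [ft_add hi (hj.const_mul _), ft_const_mul, h]; simp) x
  linarith

/-- On each half line this is an elementary exponential integral. It is the inverse direction of the
transform wanted in `ft_kap`, which follows by Fourier inversion and evenness. -/
theorem ft_exp_neg_abs {n : ℕ} (hn : 0 < n) (ξ : ℝ) :
    ft (fun v => exp (-(n * π * |v|))) ξ = kap n ξ := by
  have h : (0 : ℝ) < n := by exact_mod_cast hn
  have hp := pi_pos
  have hnp : 0 < n * π := by positivity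
  set a : ℂ := -(n * π) - 2 * π * ξ * Complex.I with ha
  set b : ℂ := n * π - 2 * π * ξ * Complex.I with hb
  have har : a.re < 0 := by simp [ha]; positivity
  have hbr : 0 < b.re := by simp [hb]; positivity
  have e1 : ∀ v ∈ Set.Ioi (0 : ℝ), Complex.exp (↑(-2 * π * v * ξ) * Complex.I) •
      ((exp (-(n * π * |v|)) : ℝ) : ℂ) = Complex.exp (a * v) := by
    intro v hv
    rw [abs_of_pos hv, smul_eq_mul, Complex.ofReal_exp, ← Complex.exp_add]
    congr 1
    rw [ha]; push_cast; ring
  have e2 : ∀ v ∈ Set.Iic (0 : ℝ), Complex.exp (↑(-2 * π * v * ξ) * Complex.I) •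
      ((exp (-(n * π * |v|)) : ℝ) : ℂ) = Complex.exp (b * v) := by
    intro v hv
    rw [abs_of_nonpos hv, smul_eq_mul, Complex.ofReal_exp, ← Complex.exp_add]
    congr 1
    rw [hb]; push_cast; ring
  rw [ft, Real.fourier_real_eq_integral_exp_smul, ← intervalIntegral.integral_Iic_add_Ioi (b := 0),
    setIntegral_congr_fun measurableSet_Iic e2, setIntegral_congr_fun measurableSet_Ioi e1,
    integral_exp_mul_complex_Iic hbr, integral_exp_mul_complex_Ioi har]
  · have ha0 : a ≠ 0 := fun h => by simp [h] at har
    have hb0 : b ≠ 0 := fun h => by simp [h] at hbr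
    have hab : a * b = -(π ^ 2 * ((n : ℝ) ^ 2 + 4 * ξ ^ 2 : ℝ)) := by
      rw [ha, hb]; push_cast
      linear_combination (-4 * π ^ 2 * ξ ^ 2 : ℂ) * (- Complex.I_sq)
    have hsub : a - b = -(2 * n * π) := by rw [ha, hb]; ring
    have hpc : (π : ℂ) ≠ 0 := by exact_mod_cast hp.ne'
    have hD : (((n : ℝ) ^ 2 + 4 * ξ ^ 2 : ℝ) : ℂ) ≠ 0 := by
      exact_mod_cast (by positivity : (n : ℝ) ^ 2 + 4 * ξ ^ 2 ≠ 0)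
    have : (1 : ℂ) / b + -1 / a = (a - b) / (a * b) := by field_simp; ring
    simp only [Complex.ofReal_zero, mul_zero, Complex.exp_zero]
    rw [this, hab, hsub, kap]
    rw [Complex.ofReal_mul, Complex.ofReal_div, Complex.ofReal_div]
    field_simp
    push_cast
    ring
  · exact (integrableOn_congr_fun e2 measurableSet_Iic).2 (integrableOn_exp_mul_complex_Iic hbr 0)
  · exact (integrableOn_congr_fun e1 measurableSet_Ioi).2 (integrableOn_exp_mul_complex_Ioi har 0)

theorem integrable_exp_neg_abs {c : ℝ} (hc : 0 < c) : Integrable fun v => exp (-(c * |v|)) := by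
  rw [← integrableOn_univ, ← Set.Iic_union_Ioi (a := (0 : ℝ)), integrableOn_union]
  constructor
  · refine (integrableOn_congr_fun (fun v hv => ?_) measurableSet_Iic).2
      (integrableOn_exp_mul_Iic hc 0)
    rw [abs_of_nonpos hv]; simp
  · refine (integrableOn_congr_fun (fun v hv => ?_) measurableSet_Ioi).2
      (integrableOn_exp_mul_Ioi (neg_lt_zero.2 hc) 0)
    rw [abs_of_pos hv]; simp

theorem ft_kap {n : ℕ} (hn : 0 < n) (ξ : ℝ) : ft (kap n) ξ = (exp (-(n * π * |ξ|)) : ℝ) := by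
  have h : (0 : ℝ) < n := by exact_mod_cast hn
  set E : ℝ → ℂ := fun v => ((exp (-(n * π * |v|)) : ℝ) : ℂ) with hE
  have h1 : 𝓕 E = fun w => (kap n w : ℂ) := funext (ft_exp_neg_abs hn)
  have h2 : 𝓕⁻ E = fun w => (kap n w : ℂ) := by
    funext w
    rw [Real.fourierInv_eq_fourier_neg, h1]
    simp only [kap_neg]
  have hc : Continuous E := by rw [hE]; fun_prop
  have := congrFun (hc.fourier_fourierInv_eq
    (integrable_exp_neg_abs (by have := pi_pos; positivity)).ofReal
    (by rw [h1]; exact (tame_kap n).integrable.ofReal)) ξ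
  rw [h2] at this
  exact this

/-- The transform is a beta integral B(z, 1-z) with z = 1/2 - iξ, up to the factor 2π; Euler's
reflection formula evaluates it as π / sin(πz) = π / cosh(πξ). -/
theorem ft_halfSech (ξ : ℝ) : ft halfSech ξ = halfSech ξ := by
  have hp := pi_pos
  set s : ℂ := 1 / 2 - ξ * Complex.I with hs
  have hs' : 1 - s = 1 / 2 + ξ * Complex.I := by rw [hs]; ring
  have hG := Complex.Gamma_mul_Gamma_eq_betaIntegral (s := s) (t := 1 - s) (by simp [hs])
    (by simp [hs'])
  rw [Complex.Gamma_mul_Gamma_one_sub, add_sub_cancel, Complex.Gamma_one, one_mul] at hG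
  have hsin : Complex.sin (π * s) = (cosh (π * ξ) : ℝ) := by
    rw [show (π : ℂ) * s = π / 2 - (π * ξ) * Complex.I by rw [hs]; ring, Complex.sin_pi_div_two_sub,
      Complex.cos_mul_I]
    push_cast; rfl
  -- The logistic substitution maps the line onto (0, 1); log w - log(1 - w) = 2πy yields the
  -- Fourier phase, and w(1 - w) is the square of `halfSech`.
  set w : ℝ → ℝ := fun y => exp (π * y) / (2 * cosh (π * y)) with hw
  have hw1 : ∀ y, 1 - w y = exp (-(π * y)) / (2 * cosh (π * y)) := by
    intro y
    have := cosh_pos (π * y)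
    rw [hw]
    field_simp
    rw [cosh_eq]; ring
  have hw0 : ∀ y, 0 < w y := fun y => by have := cosh_pos (π * y); simp only [hw]; positivity
  have hw2 : ∀ y, 0 < 1 - w y := fun y => by
    rw [hw1]; have := cosh_pos (π * y); positivity
  have hd : ∀ y, HasDerivAt w (2 * π * (w y * (1 - w y))) y := by
    intro y
    have h1 : HasDerivAt (fun y : ℝ => π * y) π y := by simpa using (hasDerivAt_id y).const_mul π
    have hc := cosh_pos (π * y)
    refine (h1.exp.div (h1.cosh.const_mul 2) (by positivity)).congr_deriv ?_
    rw [hw1, hw]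
    rw [exp_neg]
    have := exp_pos (π * y)
    field_simp
    rw [cosh_eq, sinh_eq, exp_neg]
    field_simp
    ring
  have hmono : StrictMono w := strictMono_of_hasDerivAt_pos hd fun y => by
    have := hw0 y; have := hw2 y; positivity
  have himg : w '' Set.univ = Set.Ioo 0 1 := by
    ext t
    simp only [Set.image_univ, Set.mem_range, Set.mem_Ioo]
    constructor
    · rintro ⟨y, rfl⟩
      exact ⟨hw0 y, by linarith [hw2 y]⟩
    · rintro ⟨h0, h1⟩
      have h2 : 0 < t / (1 - t) := div_pos h0 (by linarith)
      refine ⟨log (t / (1 - t)) / (2 * π), ?_⟩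
      have h3 : exp (π * (log (t / (1 - t)) / (2 * π))) ^ 2 = t / (1 - t) := by
        rw [← exp_nat_mul]
        conv_rhs => rw [← exp_log h2]
        congr 1
        push_cast
        field_simp
      simp only [hw, cosh_eq, exp_neg]
      set e := exp (π * (log (t / (1 - t)) / (2 * π))) with he
      have he0 : 0 < e := exp_pos _
      have h4 : (1 - t) ≠ 0 := by linarith
      rw [eq_div_iff h4] at h3
      field_simp
      linear_combination h3
  have hlog : ∀ y, (Real.log (w y) - Real.log (1 - w y)) = 2 * π * y := by
    intro y
    have hc := cosh_pos (π * y)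
    rw [hw1, hw]
    simp only
    rw [log_div (exp_pos _).ne' (by positivity), log_div (exp_pos _).ne' (by positivity), log_exp,
      log_exp]
    ring
  have hlog2 : ∀ y, (Real.log (w y) + Real.log (1 - w y)) = 2 * log (halfSech y) := by
    intro y
    have hc := cosh_pos (π * y)
    rw [hw1, hw, halfSech]
    simp only
    rw [log_div (exp_pos _).ne' (by positivity), log_div (exp_pos _).ne' (by positivity), log_exp,
      log_exp, one_div, log_inv]
    ring
  have hint : Complex.betaIntegral s (1 - s) = 2 * π * ft halfSech ξ := by
    rw [Complex.betaIntegral, intervalIntegral.integral_of_le zero_le_one,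
      integral_Ioc_eq_integral_Ioo, ← himg,
      integral_image_eq_integral_abs_deriv_smul MeasurableSet.univ
        (fun y _ => (hd y).hasDerivWithinAt) hmono.injective.injOn,
      setIntegral_univ, ft, Real.fourier_real_eq_integral_exp_smul, ← integral_const_mul]
    congr 1
    funext y
    have a0 := hw0 y
    have b0 := hw2 y
    have a1 : (w y : ℂ) ≠ 0 := by exact_mod_cast a0.ne'
    have b1 : ((1 - w y : ℝ) : ℂ) ≠ 0 := by exact_mod_cast b0.ne'
    have hb1 : (1 : ℂ) - w y = ((1 - w y : ℝ) : ℂ) := by push_cast; ring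
    rw [abs_of_pos (by positivity), hb1, Complex.cpow_def_of_ne_zero a1,
      Complex.cpow_def_of_ne_zero b1, ← Complex.ofReal_log a0.le, ← Complex.ofReal_log b0.le,
      ← Complex.exp_add, Complex.real_smul, smul_eq_mul]
    have k1 : 2 * π * (w y * (1 - w y)) = 2 * π * exp (log (w y) + log (1 - w y)) := by
      rw [exp_add, exp_log a0, exp_log b0]
    have k2 : halfSech y = exp ((log (w y) + log (1 - w y)) / 2) := by
      rw [hlog2, mul_div_cancel_left₀ _ two_ne_zero, exp_log (halfSech_pos y)]
    rw [k1, k2]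
    have k3 : ((log (w y) - log (1 - w y) : ℝ) : ℂ) = (2 * π * y : ℝ) := by rw [hlog]
    push_cast at k3 ⊢
    rw [mul_assoc (2 * (π : ℂ)), ← Complex.exp_add, ← Complex.exp_add]
    congr 2
    rw [hs]
    linear_combination (-ξ * Complex.I) * k3
  rw [hint, hsin] at hG
  have hpc : (2 * π : ℂ) ≠ 0 := by exact_mod_cast (by positivity : 2 * π ≠ 0)
  rw [← mul_right_inj' hpc, ← hG, halfSech]
  have := cosh_pos (π * ξ)
  have hcc : ((cosh (π * ξ) : ℝ) : ℂ) ≠ 0 := by exact_mod_cast this.ne'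
  rw [Complex.ofReal_div, Complex.ofReal_mul]
  field_simp
  norm_num

/-! ### The inversion of the kernels -/

/-- Fourier transform of e^{-nπ|ξ|} · 2 cosh(πξ) = e^{-(n-1)π|ξ|} + e^{-(n+1)π|ξ|}. For n = 1 the
kernel of index 0 ought to be a Dirac mass but is 0 here, so its convolution with s is added by
hand. -/
theorem kap_eq_conv {n : ℕ} (hn : 1 ≤ n) (x : ℝ) :
    kap n x = (if n = 1 then halfSech x else 0) + conv halfSech (kap (n - 1)) x
      + conv halfSech (kap (n + 1)) x := by
  have hsi := tame_halfSech.integrable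
  have hki : ∀ m, Integrable (kap m) := fun m => (tame_kap m).integrable
  have hcc : ∀ m, Continuous (conv halfSech (kap m)) := fun m =>
    continuous_conv hsi (tame_kap m).continuous (tame_kap m).bdd
  have hci : ∀ m, Integrable (conv halfSech (kap m)) := fun m => integrable_conv hsi (hki m)
  have key : ∀ ξ : ℝ, ∀ m : ℕ, exp (-((m + 1 : ℕ) * π * |ξ|)) =
      halfSech ξ * (exp (-(m * π * |ξ|)) + exp (-((m + 1 + 1 : ℕ) * π * |ξ|))) := by
    intro ξ m
    have hc : cosh (π * ξ) = (exp (π * |ξ|) + exp (-(π * |ξ|))) / 2 := by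
      rw [← cosh_abs, abs_mul, abs_of_pos pi_pos, cosh_eq]
    have hcp := cosh_pos (π * ξ)
    have : halfSech ξ * (exp (π * |ξ|) + exp (-(π * |ξ|))) = 1 := by
      rw [halfSech, hc] at *
      field_simp
    have e1 : exp (-(m * π * |ξ|)) = exp (-((m + 1 : ℕ) * π * |ξ|)) * exp (π * |ξ|) := by
      rw [← exp_add]; congr 1; push_cast; ring
    have e2 : exp (-((m + 1 + 1 : ℕ) * π * |ξ|))
        = exp (-((m + 1 : ℕ) * π * |ξ|)) * exp (-(π * |ξ|)) := by
      rw [← exp_add]; congr 1; push_cast; ring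
    rw [e1, e2]
    linear_combination (-exp (-((m + 1 : ℕ) * π * |ξ|))) * this
  obtain ⟨m, rfl⟩ : ∃ m, n = m + 1 := ⟨n - 1, by omega⟩
  simp only [Nat.add_sub_cancel]
  rcases Nat.eq_zero_or_pos m with rfl | hm
  · have h0 : conv halfSech (kap 0) x = 0 := by simp [conv]
    rw [h0, if_pos rfl, add_zero]
    refine eq_of_ft_eq (tame_kap _).continuous (hki _)
      (tame_halfSech.continuous.add (hcc 2)) (hsi.add (hci 2)) (fun ξ => ?_) x
    rw [Pi.add_def, ft_add hsi (hci _), ft_conv hsi (hki _), ft_halfSech, ft_kap (by norm_num),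
      ft_kap (by norm_num)]
    have := key ξ 0
    simp only [Nat.cast_zero, zero_mul, neg_zero, exp_zero] at this
    rw [this]; push_cast; ring
  · rw [if_neg (by omega), zero_add]
    refine eq_of_ft_eq (tame_kap _).continuous (hki _)
      ((hcc m).add (hcc (m + 1 + 1))) ((hci m).add (hci _)) (fun ξ => ?_) x
    rw [Pi.add_def, ft_add (hci _) (hci _), ft_conv hsi (hki _), ft_conv hsi (hki _), ft_halfSech,
      ft_kap (by omega), ft_kap hm, ft_kap (by omega), key ξ m]
    push_cast; ring

theorem integrable_mul_comp_sub {f g : ℝ → ℝ} (hf : Integrable f) (hg : Tame g) (x : ℝ) :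
    Integrable fun y => f y * g (x - y) := by
  obtain ⟨C, hC⟩ := hg.bdd
  have hc := hg.continuous
  exact hf.mul_bdd (by fun_prop) (Eventually.of_forall fun y => hC (x - y))

theorem conv_sum_right {ι : Type*} (s : Finset ι) {f : ℝ → ℝ} {g : ι → ℝ → ℝ} (hf : Integrable f)
    (hg : ∀ i ∈ s, Tame (g i)) (x : ℝ) :
    conv f (fun y => ∑ i ∈ s, g i y) x = ∑ i ∈ s, conv f (g i) x := by
  unfold conv
  simp only [Finset.mul_sum]
  exact integral_finsetSum _ fun i hi => integrable_mul_comp_sub hf (hg i hi) x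

theorem conv_add_right {f g h : ℝ → ℝ} (hf : Integrable f) (hg : Tame g) (hh : Tame h) (x : ℝ) :
    conv f (fun y => g y + h y) x = conv f g x + conv f h x := by
  unfold conv
  simp only [mul_add]
  exact integral_add (integrable_mul_comp_sub hf hg x) (integrable_mul_comp_sub hf hh x)

/-- `(1 + K)^{(a,b)} * s = σ_a^{(b)}`. -/
theorem KSite_eq_conv {a b : ℕ} (ha : 1 ≤ a) (hb : 1 ≤ b) (x : ℝ) :
    KSite a b x = (if a = b then halfSech x else 0) + conv halfSech (KTwo a b) x := by
  have hsi := tame_halfSech.integrable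
  unfold KTwo KSite
  rw [conv_sum_right _ hsi fun i _ => (tame_kap _).add (tame_kap _)]
  have h1 : ∀ i, kap (((a : ℤ) - b).natAbs + 2 * i + 1) x =
      (if ((a : ℤ) - b).natAbs + 2 * i + 1 = 1 then halfSech x else 0)
      + conv halfSech (fun y => kap (((a : ℤ) - b).natAbs + 2 * i) y
        + kap (((a : ℤ) - b).natAbs + 2 * i + 2) y) x := by
    intro i
    rw [kap_eq_conv (by omega), conv_add_right hsi (tame_kap _) (tame_kap _)]
    simp only [Nat.add_sub_cancel]
    ring
  rw [Finset.sum_congr rfl fun i _ => h1 i, Finset.sum_add_distrib]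
  congr 1
  -- Index 1 occurs in the progression only at its bottom, and only when a = b.
  rw [Finset.sum_eq_single 0]
  · congr 1
    simp only [eq_iff_iff]
    omega
  · intro i _ hi
    rw [if_neg (by omega)]
  · intro h
    simp only [Finset.mem_range, not_lt, nonpos_iff_eq_zero] at h
    omega

/-- A Gram factorisation TᵀT with T triangular, its entries being q^(a-1-j) for j < a; the
substitution i = min a b - 1 - j matches the exponents. -/
theorem sum_pow_min_eq (q : ℝ) (a b M : ℕ) (ha : a ≤ M) :
    ∑ i ∈ Finset.range (min a b), q ^ (((a : ℤ) - b).natAbs + 2 * i) =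
      ∑ j ∈ Finset.range M, (if j < a then q ^ (a - 1 - j) else 0) *
        (if j < b then q ^ (b - 1 - j) else 0) := by
  have h1 : ∑ j ∈ Finset.range M, (if j < a then q ^ (a - 1 - j) else 0) *
        (if j < b then q ^ (b - 1 - j) else 0) =
      ∑ j ∈ Finset.range (min a b), q ^ (a - 1 - j) * q ^ (b - 1 - j) := by
    symm
    refine (Finset.sum_congr rfl fun j hj => ?_).trans
      (Finset.sum_subset (Finset.range_subset_range.2 (by omega)) fun j _ hj => ?_)
    · simp only [Finset.mem_range] at hj
      rw [if_pos (by omega), if_pos (by omega)]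
    · simp only [Finset.mem_range] at hj
      by_cases h : j < a
      · rw [if_neg (by omega : ¬ j < b), mul_zero]
      · rw [if_neg h, zero_mul]
  rw [h1, ← Finset.sum_range_reflect]
  refine Finset.sum_congr rfl fun j hj => ?_
  simp only [Finset.mem_range] at hj
  rw [← pow_add]
  congr 1
  omega

/-- The symbol of `1 + K` is positive definite. -/
theorem eq_zero_of_symbol {S : Finset ℕ} {q : ℝ} (c : ℕ → ℝ)
    (hpos : ∀ a ∈ S, 1 ≤ a)
    (h : ∀ a ∈ S, ∑ b ∈ S, (∑ i ∈ Finset.range (min a b), q ^ (((a : ℤ) - b).natAbs + 2 * i)) * c b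
      = 0) : ∀ a ∈ S, c a = 0 := by
  set M := S.sup id with hM
  have hle : ∀ a ∈ S, a ≤ M := fun a ha => Finset.le_sup (f := id) ha
  set t : ℕ → ℕ → ℝ := fun j a => if j < a then q ^ (a - 1 - j) else 0 with ht
  -- The quadratic form of the system, tested on c itself, is a sum of squares.
  have hsq : ∑ j ∈ Finset.range M, (∑ a ∈ S, t j a * c a) ^ 2 = 0 := by
    calc ∑ j ∈ Finset.range M, (∑ a ∈ S, t j a * c a) ^ 2
        = ∑ j ∈ Finset.range M, ∑ a ∈ S, ∑ b ∈ S, c a * (t j a * t j b * c b) := by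
          refine Finset.sum_congr rfl fun j _ => ?_
          rw [sq, Finset.sum_mul_sum]
          exact Finset.sum_congr rfl fun a _ => Finset.sum_congr rfl fun b _ => by ring
      _ = ∑ a ∈ S, c a * ∑ b ∈ S, (∑ j ∈ Finset.range M, t j a * t j b) * c b := by
          rw [Finset.sum_comm]
          refine Finset.sum_congr rfl fun a _ => ?_
          rw [Finset.sum_comm, Finset.mul_sum]
          refine Finset.sum_congr rfl fun b _ => ?_
          rw [Finset.sum_mul, Finset.mul_sum]
      _ = 0 := by
          refine Finset.sum_eq_zero fun a ha => ?_
          have := h a ha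
          simp only [sum_pow_min_eq q a _ M (hle a ha)] at this
          rw [this, mul_zero]
  have hz : ∀ j ∈ Finset.range M, ∑ a ∈ S, t j a * c a = 0 := fun j hj =>
    pow_eq_zero_iff two_ne_zero |>.1
      ((Finset.sum_eq_zero_iff_of_nonneg fun j _ => sq_nonneg _).1 hsq j hj)
  -- Back substitution from the largest index: row a - 1 has entry 1 at a and zeros at smaller
  -- indices.
  have hind : ∀ k, ∀ a ∈ S, M < a + k → c a = 0 := by
    intro k
    induction k with
    | zero => intro a ha h'; exact absurd (hle a ha) (by omega)
    | succ k ih =>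
      intro a ha h'
      have ha1 := hpos a ha
      have h2 := hz (a - 1) (Finset.mem_range.2 (by have := hle a ha; omega))
      rw [Finset.sum_eq_single a] at h2
      · simp only [ht, if_pos (by omega : a - 1 < a), Nat.sub_self, pow_zero, one_mul] at h2
        exact h2
      · intro b hb hne
        by_cases hlt : a - 1 < b
        · rw [ih b hb (by omega), mul_zero]
        · simp only [ht, if_neg hlt, zero_mul]
      · exact fun h => absurd ha h
  exact fun a ha => hind (M + 1) a ha (by omega)

/-- The Kronecker delta restores the term q⁰ lost through `kap 0 = 0`; then every pair q^n + q^(n+2)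
has the common factor 1 + q², and the Gram matrix of `sum_pow_min_eq` remains. -/
theorem ft_KTwo {a b : ℕ} (ha : 1 ≤ a) (hb : 1 ≤ b) (ξ : ℝ) :
    (if a = b then 1 else 0) + ft (KTwo a b) ξ =
      (((1 + exp (-(π * |ξ|)) ^ 2) * ∑ i ∈ Finset.range (min a b),
        exp (-(π * |ξ|)) ^ (((a : ℤ) - b).natAbs + 2 * i) : ℝ) : ℂ) := by
  set q := exp (-(π * |ξ|)) with hq
  have hk : ∀ n : ℕ, ft (kap n) ξ = ((q ^ n : ℝ) : ℂ) - if n = 0 then 1 else 0 := by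
    intro n
    rcases Nat.eq_zero_or_pos n with rfl | hn
    · have : kap 0 = fun _ => 0 := by funext y; simp
      rw [this, ft_zero]; simp
    · rw [ft_kap hn, if_neg hn.ne', sub_zero, hq, ← exp_nat_mul]
      congr 2
      ring
  have e : KTwo a b = fun x => ∑ i ∈ Finset.range (min a b),
    (kap (((a : ℤ) - b).natAbs + 2 * i) x + kap (((a : ℤ) - b).natAbs + 2 * i + 2) x) := rfl
  rw [e, ft_sum _ fun i _ => ((tame_kap _).add (tame_kap _)).integrable]
  simp only [ft_add (tame_kap _).integrable (tame_kap _).integrable, hk]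
  have h0 : ∑ i ∈ Finset.range (min a b),
      (if ((a : ℤ) - b).natAbs + 2 * i = 0 then (1 : ℂ) else 0) = if a = b then 1 else 0 := by
    rw [Finset.sum_eq_single 0]
    · congr 1
      simp only [eq_iff_iff]
      omega
    · intro i _ hi
      rw [if_neg (by omega)]
    · intro h
      simp only [Finset.mem_range, not_lt, nonpos_iff_eq_zero] at h
      omega
  have h1 : ∀ i : ℕ, ((((q ^ (((a : ℤ) - b).natAbs + 2 * i) : ℝ) : ℂ) -
      if ((a : ℤ) - b).natAbs + 2 * i = 0 then 1 else 0) +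
      (((q ^ (((a : ℤ) - b).natAbs + 2 * i + 2) : ℝ) : ℂ) -
      if ((a : ℤ) - b).natAbs + 2 * i + 2 = 0 then 1 else 0)) =
      (((1 + q ^ 2) * q ^ (((a : ℤ) - b).natAbs + 2 * i) : ℝ) : ℂ) -
      if ((a : ℤ) - b).natAbs + 2 * i = 0 then 1 else 0 := by
    intro i
    rw [if_neg (by omega : ¬ ((a : ℤ) - b).natAbs + 2 * i + 2 = 0)]
    push_cast
    ring
  rw [Finset.sum_congr rfl fun i _ => h1 i, Finset.sum_sub_distrib, h0, Finset.mul_sum]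
  push_cast
  ring

/-- The system of convolution equations `V_a + ∑_b K^{(b,a)} * V_b = 0` has only the zero solution. -/
theorem eq_zero_of_add_conv_eq_zero {S : Finset ℕ} (hpos : ∀ a ∈ S, 1 ≤ a) {V : ℕ → ℝ → ℝ}
    (hc : ∀ a ∈ S, Continuous (V a)) (hi : ∀ a ∈ S, Integrable (V a))
    (h : ∀ a ∈ S, ∀ x, V a x + ∑ b ∈ S, conv (V b) (KTwo b a) x = 0) :
    ∀ a ∈ S, ∀ x, V a x = 0 := by
  intro a₀ ha₀
  refine eq_zero_of_ft_eq_zero (hc a₀ ha₀) (hi a₀ ha₀) fun ξ => ?_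
  set q := exp (-(π * |ξ|))
  have hK : ∀ a b, Integrable (KTwo a b) := fun a b => (tame_KTwo a b).integrable
  have h1 : ∀ a ∈ S, ∑ b ∈ S, ((∑ i ∈ Finset.range (min a b),
      q ^ (((a : ℤ) - b).natAbs + 2 * i) : ℝ) : ℂ) * ft (V b) ξ = 0 := by
    intro a ha
    have h2 : ft (fun x => V a x + ∑ b ∈ S, conv (V b) (KTwo b a) x) ξ = 0 := by
      rw [funext (h a ha), ft_zero]
    rw [ft_add (hi a ha) (integrable_finsetSum _ fun b hb => integrable_conv (hi b hb) (hK b a)),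
      ft_sum _ fun b hb => integrable_conv (hi b hb) (hK b a)] at h2
    have h3 : ft (V a) ξ = ∑ b ∈ S, (if a = b then 1 else 0) * ft (V b) ξ := by
      simp [ha]
    rw [h3, ← Finset.sum_add_distrib] at h2
    have h4 : ∀ b ∈ S, (if a = b then 1 else 0) * ft (V b) ξ + ft (conv (V b) (KTwo b a)) ξ =
        (1 + q ^ 2 : ℝ) * (((∑ i ∈ Finset.range (min a b),
          q ^ (((a : ℤ) - b).natAbs + 2 * i) : ℝ) : ℂ) * ft (V b) ξ) := by
      intro b hb
      rw [ft_conv (hi b hb) (hK b a), KTwo_comm b a, mul_comm (ft (V b) ξ), ← add_mul,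
        ft_KTwo (hpos a ha) (hpos b hb), Complex.ofReal_mul, mul_assoc]
    rw [Finset.sum_congr rfl h4, ← Finset.mul_sum] at h2
    refine (mul_eq_zero.1 h2).resolve_left ?_
    exact_mod_cast (by positivity : (1 + q ^ 2 : ℝ) ≠ 0)
  -- The symbol is real, so real and imaginary parts solve the system separately.
  have hre := eq_zero_of_symbol (q := q) (fun b => (ft (V b) ξ).re) hpos fun a ha => by
    have := congrArg Complex.re (h1 a ha)
    simpa only [Complex.re_sum, Complex.re_ofReal_mul, Complex.zero_re] using this
  have him := eq_zero_of_symbol (q := q) (fun b => (ft (V b) ξ).im) hpos fun a ha => by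
    have := congrArg Complex.im (h1 a ha)
    simpa only [Complex.im_sum, Complex.im_ofReal_mul, Complex.zero_im] using this
  exact Complex.ext (hre a₀ ha₀) (him a₀ ha₀)

/-! ### The digamma function on the positive reals -/

/-- The digamma function on the reals. -/
def realDigamma (x : ℝ) : ℝ := (Complex.digamma (x : ℂ)).re

theorem realDigamma_eq_deriv {x : ℝ} (hx : 0 < x) : realDigamma x = deriv (log ∘ Gamma) x := by
  have hne : ∀ m : ℕ, (x : ℂ) ≠ -m := fun m h => by
    have := congrArg Complex.re h
    simp at this
    linarith [(Nat.cast_nonneg m : (0 : ℝ) ≤ m)]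
  have hne' : ∀ m : ℕ, x ≠ -m := fun m h => hne m (by rw [h]; simp)
  have h1 : HasDerivAt Gamma (deriv Complex.Gamma x).re x := by
    have := (Complex.differentiableAt_Gamma _ hne).hasDerivAt.real_of_complex
    simpa only [Complex.Gamma_ofReal, Complex.ofReal_re] using this
  have h2 : deriv (log ∘ Gamma) x = (deriv Complex.Gamma x).re / Gamma x :=
    (h1.log (Gamma_pos_of_pos hx).ne').deriv
  rw [h2, realDigamma, Complex.digamma_def, logDeriv_apply, Complex.Gamma_ofReal,
    Complex.div_ofReal_re]

theorem realDigamma_add_one {x : ℝ} (hx : 0 < x) :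
    realDigamma (x + 1) = realDigamma x + 1 / x := by
  have h := Complex.digamma_apply_add_one (x : ℂ) fun m h => by
    have := congrArg Complex.re h
    simp at this
    linarith [(Nat.cast_nonneg m : (0 : ℝ) ≤ m)]
  have := congrArg Complex.re h
  rw [Complex.add_re, ← Complex.ofReal_inv, Complex.ofReal_re] at this
  simpa [realDigamma] using this

/-- Log-convexity of the Gamma function. Together with the recurrence it gives the decay of ψ(x +
1/2) - ψ(x) without asymptotic expansions. -/
theorem realDigamma_mono {x y : ℝ} (hx : 0 < x) (hxy : x ≤ y) :
    realDigamma x ≤ realDigamma y := by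
  rw [realDigamma_eq_deriv hx, realDigamma_eq_deriv (hx.trans_le hxy)]
  refine convexOn_log_Gamma.monotoneOn_deriv (fun z hz => ?_) hx (hx.trans_le hxy) hxy
  have hz' : (0 : ℝ) < z := hz
  refine (differentiableAt_Gamma fun m h => ?_).log (Gamma_pos_of_pos hz').ne'
  linarith [(Nat.cast_nonneg m : (0 : ℝ) ≤ m)]

theorem realDigamma_add_half_sub_nonneg {x : ℝ} (hx : 0 < x) :
    0 ≤ realDigamma (x + 1 / 2) - realDigamma x := by
  linarith [realDigamma_mono hx (by linarith : x ≤ x + 1 / 2)]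

theorem realDigamma_add_half_sub_le {x : ℝ} (hx : 0 < x) :
    realDigamma (x + 1 / 2) - realDigamma x ≤ 1 / x := by
  linarith [realDigamma_mono (by linarith : 0 < x + 1 / 2) (by linarith : x + 1 / 2 ≤ x + 1),
    realDigamma_add_one hx]

/-! ### The vacuum energy -/

/-- The convolution identity `kap_eq_conv` evaluated at the origin. -/
theorem integral_halfSech_mul_kap_add {n : ℕ} (hn : 2 ≤ n) :
    (∫ y, halfSech y * kap (n - 1) y) + ∫ y, halfSech y * kap (n + 1) y = 2 / (π * n) := by
  have h := kap_eq_conv (n := n) (by omega) 0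
  have h0 : (0 : ℝ) < n := by exact_mod_cast (by omega : 0 < n)
  have hp := pi_pos
  simp only [conv, zero_sub, kap_neg, if_neg (by omega : n ≠ 1), zero_add] at h
  rw [← h, kap]
  field_simp
  ring

theorem integral_halfSech_mul_kap_le {n : ℕ} (hn : 1 ≤ n) :
    |∫ y, halfSech y * kap n y| ≤ (2 / π * ∫ y, halfSech y) * (1 / n) := by
  rw [abs_of_nonneg (integral_nonneg fun y => mul_nonneg (halfSech_pos y).le (kap_nonneg n y)),
    mul_right_comm, mul_comm, ← integral_mul_const]
  refine integral_mono_of_nonneg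
    (Eventually.of_forall fun y => mul_nonneg (halfSech_pos y).le (kap_nonneg n y))
    (integrable_halfSech.mul_const _) (Eventually.of_forall fun y => ?_)
  exact mul_le_mul_of_nonneg_left (kap_le n hn y) (halfSech_pos y).le

/-- Both sides satisfy f(n) + f(n+2) = 4/(n+1) and are O(1/n). Their difference only changes sign
under n → n + 2, so its constant absolute value must be 0. -/
theorem two_pi_mul_integral_halfSech_mul_kap {n : ℕ} (hn : 1 ≤ n) :
    2 * π * ∫ y, halfSech y * kap n y =
      realDigamma ((n + 1 : ℝ) / 4 + 1 / 2) - realDigamma ((n + 1 : ℝ) / 4) := by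
  set d : ℕ → ℝ := fun n => 2 * π * (∫ y, halfSech y * kap n y) -
    (realDigamma ((n + 1 : ℝ) / 4 + 1 / 2) - realDigamma ((n + 1 : ℝ) / 4)) with hd
  have hp := pi_pos
  have hstep : ∀ m : ℕ, 1 ≤ m → d (m + 2) = -d m := by
    intro m hm
    have h1 := integral_halfSech_mul_kap_add (n := m + 1) (by omega)
    have hm0 : (0 : ℝ) < m := by exact_mod_cast hm
    have h2 := realDigamma_add_one (x := (m + 1 : ℝ) / 4) (by positivity)
    simp only [Nat.add_sub_cancel, add_assoc, Nat.reduceAdd] at h1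
    simp only [hd]
    have e1 : (((m + 2 : ℕ) : ℝ) + 1) / 4 + 1 / 2 = (m + 1 : ℝ) / 4 + 1 := by push_cast; ring
    have e2 : (((m + 2 : ℕ) : ℝ) + 1) / 4 = (m + 1 : ℝ) / 4 + 1 / 2 := by push_cast; ring
    rw [e1, e2, h2]
    have e3 : 1 / ((m + 1 : ℝ) / 4) = 2 * π * (2 / (π * ((m + 1 : ℕ) : ℝ))) := by
      push_cast; field_simp; norm_num
    rw [e3, ← h1]
    ring
  have habs : ∀ k : ℕ, |d (n + 2 * k)| = |d n| := by
    intro k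
    induction k with
    | zero => simp
    | succ k ih => rw [mul_add, mul_one, ← add_assoc, hstep _ (by omega), abs_neg, ih]
  set A := 2 * π * (2 / π * ∫ y, halfSech y) + 4 with hA
  have hA0 : 0 ≤ A := by
    have : 0 ≤ ∫ y, halfSech y := integral_nonneg fun y => (halfSech_pos y).le
    positivity
  have hbd : ∀ m : ℕ, 1 ≤ m → |d m| ≤ A * (1 / m) := by
    intro m hm
    have hm0 : (0 : ℝ) < m := by exact_mod_cast hm
    have h1 := integral_halfSech_mul_kap_le hm
    have h2 := realDigamma_add_half_sub_nonneg (x := (m + 1 : ℝ) / 4) (by positivity)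
    have h3 := realDigamma_add_half_sub_le (x := (m + 1 : ℝ) / 4) (by positivity)
    refine (abs_sub _ _).trans ?_
    rw [abs_mul, abs_of_pos (by positivity : 0 < 2 * π), abs_of_nonneg h2, hA, add_mul, mul_assoc (2 * π)]
    refine add_le_add (mul_le_mul_of_nonneg_left h1 (by positivity)) (h3.trans ?_)
    rw [one_div_div, mul_one_div]
    gcongr
    linarith
  have hlim : Tendsto (fun k : ℕ => A * (1 / ((n + 2 * k : ℕ) : ℝ))) atTop (𝓝 0) := by
    have : Tendsto (fun k : ℕ => n + 2 * k) atTop atTop :=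
      tendsto_atTop_mono (fun k => by omega : ∀ k, k ≤ n + 2 * k) tendsto_id
    simpa using (tendsto_one_div_atTop_nhds_zero_nat.comp this).const_mul A
  have h0 : |d n| ≤ 0 := ge_of_tendsto' hlim fun k => by
    rw [← habs k]; exact hbd _ (by omega)
  have := abs_nonpos_iff.1 h0
  simp only [hd] at this
  linarith

/-- The indices of `KSite` increase by 2, which shifts the digamma argument by 1/2, so the sum
telescopes. -/
theorem two_pi_mul_integral_halfSech_mul_KSite {a b : ℕ} :
    2 * π * ∫ y, halfSech y * KSite a b y =
      realDigamma (((a : ℝ) / 2 + (b : ℝ) / 2 + 1) / 2)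
        - realDigamma ((|(a : ℝ) / 2 - (b : ℝ) / 2| + 1) / 2) := by
  unfold KSite
  simp only [Finset.mul_sum]
  rw [integral_finsetSum, Finset.mul_sum]
  · set d := ((a : ℤ) - b).natAbs with hd
    have h1 : ∀ i : ℕ, 2 * π * ∫ y, halfSech y * kap (d + 2 * i + 1) y =
        realDigamma (((d : ℝ) / 2 + ((i + 1 : ℕ) : ℝ) + 1) / 2)
          - realDigamma (((d : ℝ) / 2 + (i : ℝ) + 1) / 2) := by
      intro i
      rw [two_pi_mul_integral_halfSech_mul_kap (by omega)]
      congr 2 <;> push_cast <;> ring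
    rw [Finset.sum_congr rfl fun i _ => h1 i,
      Finset.sum_range_sub fun i : ℕ => realDigamma (((d : ℝ) / 2 + (i : ℝ) + 1) / 2)]
    have hd1 : (d : ℝ) = |(a : ℝ) - b| := by
      rw [hd, Nat.cast_natAbs]; push_cast; rfl
    have e2 : |(a : ℝ) / 2 - (b : ℝ) / 2| = d / 2 := by
      rw [hd1, ← sub_div, abs_div, abs_of_pos (by norm_num : (0 : ℝ) < 2)]
    have e1 : (a : ℝ) / 2 + (b : ℝ) / 2 = d / 2 + ((min a b : ℕ) : ℝ) := by
      have : a + b = d + 2 * min a b := by omega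
      have : (a : ℝ) + b = d + 2 * (min a b : ℕ) := by exact_mod_cast this
      linarith
    rw [e1, e2]
    simp
  · intro i _
    obtain ⟨C, hC⟩ := (tame_kap (((a : ℤ) - b).natAbs + 2 * i + 1)).bdd
    exact integrable_halfSech.mul_bdd (tame_kap _).continuous.aestronglyMeasurable
      (Eventually.of_forall hC)

theorem vacuumEnergy_eq (C : Motif) (a : ℕ) :
    C.vacuumEnergy a = -∑ b ∈ C.spins, C.rho b * (2 * π * ∫ y, halfSech y * KSite b a y) := by
  simp only [two_pi_mul_integral_halfSech_mul_KSite]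
  rfl

/-! ### Counting functions and their remainder -/

/-- A function `u` with limits `0` and `P` at `∓∞` which takes every half-odd value at most once,
and an enumeration `pt` of the points where it takes the values `1/2, …, P - 1/2`. -/
structure CountingProfile (ι : Type*) [Fintype ι] where
  P : ℕ
  u : ℝ → ℝ
  contDiff : ContDiff ℝ 1 u
  bdd_deriv : ∃ C, ∀ x, |deriv u x| ≤ C
  tendsto_atBot : Tendsto u atBot (𝓝 0)
  tendsto_atTop : Tendsto u atTop (𝓝 P)
  unique : ∀ i : ℤ, ∀ x y, u x = i + 1 / 2 → u y = i + 1 / 2 → x = y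
  pt : ι → ℝ
  label : ι → ℕ
  label_injective : Function.Injective label
  range_label : ∀ i, i ∈ Set.range label ↔ i < P
  u_pt : ∀ j, u (pt j) = label j + 1 / 2

namespace CountingProfile

variable {ι : Type*} [Fintype ι] (D : CountingProfile ι)

theorem continuous : Continuous D.u := D.contDiff.continuous

theorem hasDerivAt (x : ℝ) : HasDerivAt D.u (deriv D.u x) x :=
  (D.contDiff.differentiable one_ne_zero x).hasDerivAt

theorem continuous_deriv : Continuous (deriv D.u) := D.contDiff.continuous_deriv le_rfl

/-- The difference between `u` and the number of enumerated points to the left. -/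
def rem (t : ℝ) : ℝ := D.u t - ∑ j, if D.pt j ≤ t then 1 else 0

theorem exists_gt_of_lt {x c : ℝ} (h : D.u x < c) (hc : c < D.P) : ∃ y, x < y ∧ D.u y = c := by
  obtain ⟨z, hz, hxz⟩ :=
    ((D.tendsto_atTop.eventually (lt_mem_nhds hc)).and (eventually_gt_atTop x)).exists
  obtain ⟨y, hy, hyc⟩ := intermediate_value_Ioo hxz.le D.continuous.continuousOn ⟨h, hz⟩
  exact ⟨y, hy.1, hyc⟩

theorem exists_gt_of_gt {x c : ℝ} (h : c < D.u x) (hc : D.P < c) : ∃ y, x < y ∧ D.u y = c := by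
  obtain ⟨z, hz, hxz⟩ :=
    ((D.tendsto_atTop.eventually (gt_mem_nhds hc)).and (eventually_gt_atTop x)).exists
  obtain ⟨y, hy, hyc⟩ := intermediate_value_Ioo' hxz.le D.continuous.continuousOn ⟨hz, h⟩
  exact ⟨y, hy.1, hyc⟩

theorem exists_lt_of_gt {x c : ℝ} (h : c < D.u x) (hc : 0 < c) : ∃ y, y < x ∧ D.u y = c := by
  obtain ⟨z, hz, hxz⟩ :=
    ((D.tendsto_atBot.eventually (gt_mem_nhds hc)).and (eventually_lt_atBot x)).exists
  obtain ⟨y, hy, hyc⟩ := intermediate_value_Ioo hxz.le D.continuous.continuousOn ⟨hz, h⟩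
  exact ⟨y, hy.2, hyc⟩

theorem exists_lt_of_lt {x c : ℝ} (h : D.u x < c) (hc : c < 0) : ∃ y, y < x ∧ D.u y = c := by
  obtain ⟨z, hz, hxz⟩ :=
    ((D.tendsto_atBot.eventually (lt_mem_nhds hc)).and (eventually_lt_atBot x)).exists
  obtain ⟨y, hy, hyc⟩ := intermediate_value_Ioo' hxz.le D.continuous.continuousOn ⟨h, hz⟩
  exact ⟨y, hy.2, hyc⟩

theorem label_lt (j : ι) : D.label j < D.P := (D.range_label _).1 ⟨j, rfl⟩

/-- A substitute for monotonicity of u. If u were below the level to the right of the point, or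
above it to the left, its limits at ±∞ would force a second crossing of the level, against
uniqueness. -/
theorem pt_le_iff (j : ι) (t : ℝ) : D.pt j ≤ t ↔ (D.label j : ℝ) + 1 / 2 ≤ D.u t := by
  have hP : (D.label j : ℝ) + 1 ≤ D.P := by exact_mod_cast D.label_lt j
  have huniq : ∀ y, D.u y = D.label j + 1 / 2 → y = D.pt j := fun y hy =>
    D.unique (D.label j) y (D.pt j) (by exact_mod_cast hy) (by exact_mod_cast D.u_pt j)
  constructor
  · intro h
    by_contra! hlt
    obtain ⟨y, hy, hyc⟩ := D.exists_gt_of_lt hlt (by linarith)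
    linarith [huniq y hyc]
  · intro h
    rcases h.eq_or_lt with h | h
    · exact (huniq t h.symm).ge
    · obtain ⟨y, hy, hyc⟩ := D.exists_lt_of_gt h (by positivity)
      linarith [huniq y hyc]

/-- A dip below -1/2 would cross that level on both sides, since both limits are above it. This is
why uniqueness is also demanded of quantum numbers outside the allowed range. -/
theorem neg_half_le (t : ℝ) : -(1 / 2) ≤ D.u t := by
  by_contra! h
  have hP : (0 : ℝ) ≤ D.P := Nat.cast_nonneg _
  obtain ⟨y, hy, hyc⟩ := D.exists_gt_of_lt h (by linarith)
  obtain ⟨z, hz, hzc⟩ := D.exists_lt_of_lt h (by norm_num)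
  have := D.unique (-1) y z (by rw [hyc]; norm_num) (by rw [hzc]; norm_num)
  linarith

theorem le_add_half (t : ℝ) : D.u t ≤ D.P + 1 / 2 := by
  by_contra! h
  have hP : (0 : ℝ) ≤ D.P := Nat.cast_nonneg _
  obtain ⟨y, hy, hyc⟩ := D.exists_gt_of_gt h (by linarith)
  obtain ⟨z, hz, hzc⟩ := D.exists_lt_of_gt h (by linarith)
  have := D.unique D.P y z (by rw [hyc]; norm_num) (by rw [hzc]; norm_num)
  linarith

theorem sum_ite_label (p : ℕ → Prop) [DecidablePred p] :
    ∑ j, (if p (D.label j) then (1 : ℝ) else 0) = ∑ i ∈ Finset.range D.P, if p i then 1 else 0 := by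
  classical
  have : Finset.range D.P = Finset.univ.image D.label := by
    ext i
    rw [Finset.mem_range, ← D.range_label]
    simp
  rw [this, Finset.sum_image fun _ _ _ _ h => D.label_injective h]

/-- The number of enumerated points to the left of `t`. -/
theorem sum_ite_pt (t : ℝ) :
    (∑ j, if D.pt j ≤ t then (1 : ℝ) else 0) = ((min D.P ⌊D.u t + 1 / 2⌋₊ : ℕ) : ℝ) := by
  classical
  have h0 : 0 ≤ D.u t + 1 / 2 := by linarith [D.neg_half_le t]
  simp only [D.pt_le_iff]
  rw [D.sum_ite_label fun i => (i : ℝ) + 1 / 2 ≤ D.u t, Finset.sum_boole]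
  congr 1
  rw [← Finset.card_range (min D.P ⌊D.u t + 1 / 2⌋₊)]
  congr 1
  ext i
  simp only [Finset.mem_filter, Finset.mem_range, lt_min_iff, and_congr_right_iff]
  intro _
  rw [Nat.lt_iff_add_one_le, Nat.le_floor_iff h0]
  push_cast
  constructor <;> intro h <;> linarith

/-- The count of points is u rounded to the nearest integer and capped at P; the cap is harmless
because u ≤ P + 1/2. -/
theorem abs_rem_le (t : ℝ) : |D.rem t| ≤ 1 / 2 := by
  have h0 : 0 ≤ D.u t + 1 / 2 := by linarith [D.neg_half_le t]
  have h1 := D.le_add_half t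
  have h2 := Nat.floor_le h0
  have h3 := Nat.lt_floor_add_one (D.u t + 1 / 2)
  rw [rem, D.sum_ite_pt, abs_le]
  rcases le_total D.P ⌊D.u t + 1 / 2⌋₊ with h | h
  · rw [min_eq_left h]
    have h' : (D.P : ℝ) ≤ ⌊D.u t + 1 / 2⌋₊ := by exact_mod_cast h
    constructor <;> linarith
  · rw [min_eq_right h]
    constructor <;> linarith

theorem measurable_rem : Measurable D.rem := by
  refine D.continuous.measurable.sub (Finset.measurable_fun_sum _ fun j _ => ?_)
  exact Measurable.ite measurableSet_Ici measurable_const measurable_const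

/-- The remainder jumps between 1/2 and -1/2, but its square is the squared distance from u to the
integers, which is continuous in t. -/
theorem rem_sq (t : ℝ) : D.rem t ^ 2 = ‖(D.u t : UnitAddCircle)‖ ^ 2 := by
  have h1 : (D.u t : UnitAddCircle) = (D.rem t : UnitAddCircle) := by
    rw [rem, D.sum_ite_pt, AddCircle.coe_sub]
    have : (((min D.P ⌊D.u t + 1 / 2⌋₊ : ℕ) : ℝ) : UnitAddCircle) = 0 := by
      rw [AddCircle.coe_eq_zero_iff]
      exact ⟨(min D.P ⌊D.u t + 1 / 2⌋₊ : ℕ), by simp⟩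
    rw [this, sub_zero]
  rw [h1, (AddCircle.norm_coe_eq_abs_iff (p := 1) one_ne_zero).2 (by simpa using D.abs_rem_le t),
    sq_abs]

theorem continuous_rem_sq : Continuous fun t => D.rem t ^ 2 := by
  simp only [D.rem_sq]
  exact ((AddCircle.continuous_mk' 1).comp D.continuous).norm.pow 2

theorem countable_levels : {t | ∃ i : ℤ, D.u t = i + 1 / 2}.Countable := by
  have : {t | ∃ i : ℤ, D.u t = i + 1 / 2} = ⋃ i : ℤ, {t | D.u t = i + 1 / 2} := by
    ext t; simp
  rw [this]
  exact Set.countable_iUnion fun i =>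
    Set.Subsingleton.countable fun x hx y hy => D.unique i x y hx hy

theorem hasDerivAt_rem_sq {t : ℝ} (ht : ¬ ∃ i : ℤ, D.u t = i + 1 / 2) :
    HasDerivAt (fun t => D.rem t ^ 2) (2 * D.rem t * deriv D.u t) t := by
  set m : ℕ := min D.P ⌊D.u t + 1 / 2⌋₊ with hm
  have hr : D.rem t = D.u t - m := by rw [rem, D.sum_ite_pt]
  have habs := D.abs_rem_le t
  have hlt : |D.u t - m| < 1 / 2 := by
    rw [← hr]
    refine lt_of_le_of_ne habs fun h => ht ?_
    rw [hr] at h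
    rcases abs_eq (by norm_num : (0 : ℝ) ≤ 1 / 2) |>.1 h with h | h
    · exact ⟨m, by push_cast; linarith⟩
    · exact ⟨(m : ℤ) - 1, by push_cast; linarith⟩
  -- As long as |u - m| < 1/2, the integer m stays the nearest one.
  have hev : (fun t => D.rem t ^ 2) =ᶠ[𝓝 t] fun t => (D.u t - m) ^ 2 := by
    have hc : Continuous fun t => |D.u t - m| := by have := D.continuous; fun_prop
    filter_upwards [hc.continuousAt.eventually (gt_mem_nhds hlt)] with y hy
    rw [D.rem_sq]
    have h1 : (D.u y : UnitAddCircle) = ((D.u y - m : ℝ) : UnitAddCircle) := by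
      have : ((m : ℝ) : UnitAddCircle) = 0 := by
        rw [AddCircle.coe_eq_zero_iff]
        exact ⟨m, by simp⟩
      rw [AddCircle.coe_sub, this, sub_zero]
    rw [h1, (AddCircle.norm_coe_eq_abs_iff (p := 1) one_ne_zero).2 (by simpa using hy.le), sq_abs]
  refine HasDerivAt.congr_of_eventuallyEq ?_ hev
  rw [hr]
  have := ((D.hasDerivAt t).sub_const (m : ℝ)).pow 2
  refine this.congr_deriv ?_
  simp

theorem abs_u_le (t : ℝ) : |D.u t| ≤ D.P + 1 / 2 := by
  have hP : (0 : ℝ) ≤ D.P := Nat.cast_nonneg _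
  rw [abs_le]
  constructor <;> linarith [D.neg_half_le t, D.le_add_half t]

/-- Sums over the enumerated points as integrals. -/
theorem sum_pt_eq {f : ℝ → ℝ} (hf : Tame f) :
    ∑ j, f (D.pt j) = (∫ t, f t * deriv D.u t) + ∫ t, deriv f t * D.rem t := by
  obtain ⟨C, hC⟩ := D.bdd_deriv
  have hu : Integrable fun t => deriv f t * D.u t :=
    hf.integrable_deriv.mul_bdd D.continuous.aestronglyMeasurable (Eventually.of_forall D.abs_u_le)
  have hfu : Integrable fun t => f t * deriv D.u t :=
    hf.integrable.mul_bdd D.continuous_deriv.aestronglyMeasurable (Eventually.of_forall hC)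
  -- No boundary terms arise, since u is bounded and f is integrable.
  have hparts : ∫ t, f t * deriv D.u t = -∫ t, deriv f t * D.u t :=
    integral_mul_deriv_eq_deriv_mul_of_integrable (fun x _ => hf.hasDerivAt x)
      (fun x _ => D.hasDerivAt x) hfu hu
      (hf.integrable.mul_bdd D.continuous.aestronglyMeasurable (Eventually.of_forall D.abs_u_le))
  have hpt : ∀ c, ∫ t, deriv f t * (if c ≤ t then 1 else 0) = -f c := by
    intro c
    have : (fun t => deriv f t * (if c ≤ t then (1 : ℝ) else 0)) = (Set.Ici c).indicator (deriv f) := by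
      funext t
      by_cases h : c ≤ t <;> simp [Set.indicator, h]
    rw [this, integral_indicator measurableSet_Ici, integral_Ici_eq_integral_Ioi,
      integral_Ioi_of_hasDerivAt_of_tendsto' (fun x _ => hf.hasDerivAt x)
        hf.integrable_deriv.integrableOn hf.tendsto_atTop, zero_sub]
  have hi : ∀ c, Integrable fun t => deriv f t * (if c ≤ t then (1 : ℝ) else 0) := by
    intro c
    refine hf.integrable_deriv.mul_bdd (c := 1)
      (Measurable.ite measurableSet_Ici measurable_const measurable_const).aestronglyMeasurable
      (Eventually.of_forall fun t => ?_)
    by_cases h : c ≤ t <;> simp [h]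
  have hrem : ∫ t, deriv f t * D.rem t = (∫ t, deriv f t * D.u t) + ∑ j, f (D.pt j) := by
    simp only [rem, mul_sub, Finset.mul_sum]
    rw [integral_sub hu (integrable_finsetSum _ fun j _ => hi _),
      integral_finsetSum _ fun j _ => hi _]
    simp only [hpt, Finset.sum_neg_distrib, sub_neg_eq_add]
  rw [hrem, hparts]
  ring

theorem abs_integral_mul_rem_le {f : ℝ → ℝ} (hf : Integrable f) :
    |∫ t, f t * D.rem t| ≤ 1 / 2 * ∫ t, |f t| := by
  rw [← integral_const_mul]
  rw [← norm_eq_abs]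
  refine norm_integral_le_of_norm_le (hf.abs.const_mul _) (Eventually.of_forall fun t => ?_)
  simp only [norm_eq_abs, abs_mul]
  rw [mul_comm]
  exact mul_le_mul_of_nonneg_right (D.abs_rem_le t) (abs_nonneg _)

theorem integrable_mul_rem {f : ℝ → ℝ} (hf : Integrable f) : Integrable fun t => f t * D.rem t :=
  hf.mul_bdd D.measurable_rem.aestronglyMeasurable (Eventually.of_forall D.abs_rem_le)

/-- The remainder oscillates around zero. -/
theorem integral_mul_rem_mul_deriv {g : ℝ → ℝ} (hg : Tame g) :
    ∫ t, g t * D.rem t * deriv D.u t = -(1 / 2) * ∫ t, deriv g t * D.rem t ^ 2 := by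
  obtain ⟨C, hC⟩ := D.bdd_deriv
  have hsq : ∀ t, |D.rem t ^ 2| ≤ (1 / 2) ^ 2 := fun t => by
    rw [abs_pow]; exact pow_le_pow_left₀ (abs_nonneg _) (D.abs_rem_le t) 2
  have hi1 : Integrable fun t => deriv g t * D.rem t ^ 2 :=
    hg.integrable_deriv.mul_bdd D.continuous_rem_sq.aestronglyMeasurable (Eventually.of_forall hsq)
  have hi2 : Integrable fun t => g t * D.rem t * deriv D.u t :=
    (D.integrable_mul_rem hg.integrable).mul_bdd D.continuous_deriv.aestronglyMeasurable
      (Eventually.of_forall hC)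
  set F : ℝ → ℝ := fun t => g t * D.rem t ^ 2 with hF
  set F' : ℝ → ℝ := fun t => deriv g t * D.rem t ^ 2 + 2 * (g t * D.rem t * deriv D.u t) with hF'
  have hi : Integrable F' := hi1.add (hi2.const_mul 2)
  have hftc : ∀ n : ℕ, ∫ t in (-(n : ℝ))..n, F' t = F n - F (-n) := by
    intro n
    -- g r² is continuous and differentiable except where u is half-odd; each such value is taken at
    -- most once, so the exceptional set is countable.
    refine integral_eq_of_hasDerivAt_off_countable F F' D.countable_levels
      (hg.continuous.mul D.continuous_rem_sq).continuousOn (fun t ht => ?_) hi.intervalIntegrable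
    refine ((hg.hasDerivAt t).mul (D.hasDerivAt_rem_sq ht.2)).congr_deriv ?_
    simp only [hF']
    ring
  have hn : Tendsto (fun n : ℕ => (n : ℝ)) atTop atTop := tendsto_natCast_atTop_atTop
  have hn' : Tendsto (fun n : ℕ => -(n : ℝ)) atTop atBot := tendsto_neg_atTop_atBot.comp hn
  have hbd : ∀ t, |F t| ≤ |g t| * (1 / 2) ^ 2 := fun t => by
    simp only [hF, abs_mul]
    exact mul_le_mul_of_nonneg_left (hsq t) (abs_nonneg _)
  have hF0 : ∀ {l : Filter ℝ}, Tendsto g l (𝓝 0) → Tendsto F l (𝓝 0) := fun {l} h =>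
    squeeze_zero_norm hbd (by
      have := h.abs.mul_const ((1 / 2 : ℝ) ^ 2)
      rwa [abs_zero, zero_mul] at this)
  have hlim := intervalIntegral_tendsto_integral hi hn' hn
  simp only [hftc] at hlim
  have hlim' : Tendsto (fun n : ℕ => F n - F (-n)) atTop (𝓝 0) := by
    simpa using ((hF0 hg.tendsto_atTop).comp hn).sub ((hF0 hg.tendsto_atBot).comp hn')
  have h0 := tendsto_nhds_unique hlim hlim'
  rw [hF', integral_add hi1 (hi2.const_mul 2), integral_const_mul] at h0
  linarith

/-- The bound does not involve u: although u' may be of order L, cancellation keeps the integral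
bounded, and division by L makes it vanish in the limit. -/
theorem abs_integral_mul_rem_mul_deriv_le {g : ℝ → ℝ} (hg : Tame g) :
    |∫ t, g t * D.rem t * deriv D.u t| ≤ ∫ t, |deriv g t| := by
  rw [D.integral_mul_rem_mul_deriv hg, abs_mul]
  have h : |∫ t, deriv g t * D.rem t ^ 2| ≤ ∫ t, |deriv g t| := by
    rw [← norm_eq_abs]
    refine norm_integral_le_of_norm_le hg.integrable_deriv.abs (Eventually.of_forall fun t => ?_)
    simp only [norm_eq_abs, abs_mul, abs_pow]
    refine mul_le_of_le_one_right (abs_nonneg _) (pow_le_one₀ (abs_nonneg _) ?_)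
    linarith [D.abs_rem_le t]
  have h0 : 0 ≤ ∫ t, |deriv g t| := integral_nonneg fun t => abs_nonneg _
  have : |-(1 / 2 : ℝ)| = 1 / 2 := by norm_num
  rw [this]
  linarith

/-- The increments of `u` are bounded below, and bounded above by `P`. -/
theorem integral_deriv_mem (x y : ℝ) (hxy : x ≤ y) :
    -1 ≤ (∫ t in x..y, deriv D.u t) ∧ (∫ t in x..y, deriv D.u t) ≤ D.P + 1 := by
  rw [intervalIntegral.integral_eq_sub_of_hasDerivAt (fun t _ => D.hasDerivAt t)
    (D.continuous_deriv.intervalIntegrable _ _)]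
  refine ⟨?_, by linarith [D.neg_half_le x, D.le_add_half y]⟩
  have hx := abs_le.1 (D.abs_rem_le x)
  have hy := abs_le.1 (D.abs_rem_le y)
  -- The count is monotone and u differs from it by at most 1/2 at either end, so u cannot fall by
  -- more than 1.
  have hmono : ∑ j, (if D.pt j ≤ x then (1 : ℝ) else 0) ≤ ∑ j, if D.pt j ≤ y then (1 : ℝ) else 0 := by
    refine Finset.sum_le_sum fun j _ => ?_
    by_cases h : D.pt j ≤ x
    · rw [if_pos h, if_pos (h.trans hxy)]
    · rw [if_neg h]; split_ifs <;> norm_num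
  simp only [rem] at hx hy
  linarith [hx.1, hx.2, hy.1, hy.2]

end CountingProfile

/-! ### Compactness -/

/-- Countably many sequences of equibounded equi-Lipschitz functions on the line have a common
pointwise convergent subsequence. -/
theorem exists_subseq_pointwise {ι : Type*} [Countable ι] (v : ℕ → ι → ℝ → ℝ) (C : ℝ)
    (hb : ∀ n i x, |v n i x| ≤ C) (hl : ∀ n i x y, |v n i x - v n i y| ≤ C * |x - y|) :
    ∃ φ : ℕ → ℕ, StrictMono φ ∧ ∃ W : ι → ℝ → ℝ,
      ∀ i x, Tendsto (fun n => v (φ n) i x) atTop (𝓝 (W i x)) := by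
  -- Values at rational points form a sequence in a countable product of compact intervals; the
  -- Lipschitz bound then carries convergence to every real point.
  have hK : IsCompact (Set.univ.pi fun _ : ι × ℚ => Set.Icc (-C) C) :=
    isCompact_univ_pi fun _ => isCompact_Icc
  obtain ⟨w, -, φ, hφ, hw⟩ := hK.isSeqCompact (x := fun n p => v n p.1 p.2)
    fun n p _ => abs_le.1 (hb n p.1 p.2)
  rw [tendsto_pi_nhds] at hw
  refine ⟨φ, hφ, ?_⟩
  have hcau : ∀ i x, ∃ l, Tendsto (fun n => v (φ n) i x) atTop (𝓝 l) := by
    intro i x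
    refine cauchySeq_tendsto_of_complete (Metric.cauchySeq_iff'.2 fun ε hε => ?_)
    have hC : 0 ≤ C := (abs_nonneg _).trans (hb 0 i x)
    obtain ⟨q, hq1, hq2⟩ := exists_rat_btwn (show x < x + ε / (4 * (C + 1)) by
      have : 0 < ε / (4 * (C + 1)) := by positivity
      linarith)
    have hqx : C * |x - q| ≤ ε / 4 := by
      rw [abs_sub_comm, abs_of_pos (by linarith)]
      calc C * (q - x) ≤ (C + 1) * (ε / (4 * (C + 1))) := by
            gcongr
            · linarith
            · linarith
        _ = ε / 4 := by field_simp
    obtain ⟨N, hN⟩ := Metric.cauchySeq_iff'.1 (hw (i, q)).cauchySeq (ε / 4) (by linarith)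
    refine ⟨N, fun n hn => ?_⟩
    have h1 := hN n hn
    rw [Real.dist_eq, abs_lt] at h1 ⊢
    have h2 := abs_le.1 ((hl (φ n) i x q).trans hqx)
    have h3 := abs_le.1 ((hl (φ N) i x q).trans hqx)
    simp only [Function.comp_apply] at h1
    constructor <;> linarith [h1.1, h1.2, h2.1, h2.2, h3.1, h3.2]
  choose W hW using hcau
  exact ⟨W, hW⟩

theorem nonneg_of_intervalIntegral_nonneg {W : ℝ → ℝ} (hW : Continuous W)
    (h : ∀ x y, x ≤ y → 0 ≤ ∫ t in x..y, W t) (x : ℝ) : 0 ≤ W x := by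
  have hmono : Monotone fun y => ∫ t in (0 : ℝ)..y, W t := fun y z hyz => by
    have := intervalIntegral.integral_add_adjacent_intervals (hW.intervalIntegrable 0 y)
      (hW.intervalIntegrable (μ := volume) y z)
    simp only
    linarith [h y z hyz]
  rw [← hW.deriv_integral W 0 x]
  exact hmono.deriv_nonneg

theorem continuous_of_abs_sub_le {W : ℝ → ℝ} {C : ℝ} (h : ∀ x y, |W x - W y| ≤ C * |x - y|) :
    Continuous W := by
  refine LipschitzWith.continuous (K := C.toNNReal) (LipschitzWith.of_dist_le_mul fun x y => ?_)
  rw [Real.dist_eq, Real.dist_eq]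
  exact (h x y).trans (mul_le_mul_of_nonneg_right (Real.le_coe_toNNReal C) (abs_nonneg _))

theorem tendsto_conv {v : ℕ → ℝ → ℝ} {W f : ℝ → ℝ} {C : ℝ} (hc : ∀ n, Continuous (v n))
    (hb : ∀ n x, |v n x| ≤ C) (hW : ∀ x, Tendsto (fun n => v n x) atTop (𝓝 (W x)))
    (hf : Tame f) (x : ℝ) : Tendsto (fun n => conv (v n) f x) atTop (𝓝 (conv W f x)) := by
  have hfc := hf.continuous
  refine tendsto_integral_of_dominated_convergence (fun y => C * |f (x - y)|) (fun n => ?_) ?_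
    (fun n => Eventually.of_forall fun y => ?_)
    (Eventually.of_forall fun y => (hW y).mul_const _)
  · have := hc n
    exact Continuous.aestronglyMeasurable (by fun_prop)
  · exact (hf.comp_sub_left x).integrable.abs.const_mul C
  · rw [norm_eq_abs, abs_mul]
    exact mul_le_mul_of_nonneg_right (hb n y) (abs_nonneg _)

/-- The densities solving the linear integral equations up to a vanishing error converge, along a
subsequence, to the ground state densities `ρ_a / (2 cosh (π x))`. -/
theorem exists_subseq_tendsto_density {S : Finset ℕ} (hpos : ∀ a ∈ S, 1 ≤ a) (ρ : ℕ → ℝ)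
    (v : ℕ → ℕ → ℝ → ℝ) (C : ℝ) (ε : ℕ → ℝ) (hε : Tendsto ε atTop (𝓝 0))
    (hb : ∀ n, ∀ a ∈ S, ∀ x, |v n a x| ≤ C)
    (hl : ∀ n, ∀ a ∈ S, ∀ x y, |v n a x - v n a y| ≤ C * |x - y|)
    (heq : ∀ n, ∀ a ∈ S, ∀ x, |v n a x + ∑ b ∈ S, conv (v n b) (KTwo b a) x
      - ∑ p ∈ S, ρ p * KSite p a x| ≤ ε n)
    (hint : ∀ n, ∀ a ∈ S, ∀ x y, x ≤ y →
      -ε n ≤ (∫ t in x..y, v n a t) ∧ (∫ t in x..y, v n a t) ≤ C) :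
    ∃ φ : ℕ → ℕ, StrictMono φ ∧ ∀ a ∈ S, ∀ x,
      Tendsto (fun n => v (φ n) a x) atTop (𝓝 (ρ a * halfSech x)) := by
  obtain ⟨φ, hφ, W', hW'⟩ := exists_subseq_pointwise (ι := S) (fun n a => v n a) C
    (fun n a => hb n a a.2) fun n a => hl n a a.2
  refine ⟨φ, hφ, ?_⟩
  set W : ℕ → ℝ → ℝ := fun a => if h : a ∈ S then W' ⟨a, h⟩ else 0 with hWdef
  have hW : ∀ a ∈ S, ∀ x, Tendsto (fun n => v (φ n) a x) atTop (𝓝 (W a x)) := by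
    intro a ha x
    simp only [hWdef, dif_pos ha]
    exact hW' ⟨a, ha⟩ x
  have hεφ := hε.comp hφ.tendsto_atTop
  have hvc : ∀ n, ∀ a ∈ S, Continuous (v n a) := fun n a ha => continuous_of_abs_sub_le (hl n a ha)
  have hWl : ∀ a ∈ S, ∀ x y, |W a x - W a y| ≤ C * |x - y| := fun a ha x y =>
    le_of_tendsto ((hW a ha x).sub (hW a ha y)).abs (Eventually.of_forall fun n => hl _ a ha x y)
  have hWc : ∀ a ∈ S, Continuous (W a) := fun a ha => continuous_of_abs_sub_le (hWl a ha)
  have hWint : ∀ a ∈ S, ∀ x y, x ≤ y → 0 ≤ (∫ t in x..y, W a t) ∧ (∫ t in x..y, W a t) ≤ C := by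
    intro a ha x y hxy
    have hlim : Tendsto (fun n => ∫ t in x..y, v (φ n) a t) atTop (𝓝 (∫ t in x..y, W a t)) := by
      refine intervalIntegral.tendsto_integral_filter_of_dominated_convergence (fun _ => C)
        (Eventually.of_forall fun n => (hvc _ a ha).aestronglyMeasurable)
        (Eventually.of_forall fun n => Eventually.of_forall fun t _ => hb _ a ha t)
        intervalIntegrable_const (Eventually.of_forall fun t _ => hW a ha t)
    refine ⟨?_, le_of_tendsto hlim (Eventually.of_forall fun n => (hint _ a ha x y hxy).2)⟩
    have := le_of_tendsto_of_tendsto' hεφ.neg hlim fun n => (hint _ a ha x y hxy).1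
    simpa using this
  have hW0 : ∀ a ∈ S, ∀ x, 0 ≤ W a x := fun a ha =>
    nonneg_of_intervalIntegral_nonneg (hWc a ha) fun x y hxy => (hWint a ha x y hxy).1
  have hn : Tendsto (fun n : ℕ => (n : ℝ)) atTop atTop := tendsto_natCast_atTop_atTop
  have hn' : Tendsto (fun n : ℕ => -(n : ℝ)) atTop atBot := tendsto_neg_atTop_atBot.comp hn
  -- Pointwise limits need not be integrable, yet the Fourier argument requires it. Nonnegativity
  -- converts the bound on increments into a bound on the L¹ norm over [-n, n].
  have hWi : ∀ a ∈ S, Integrable (W a) := fun a ha =>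
    integrable_of_intervalIntegral_norm_bounded (l := atTop) (a := fun n : ℕ => -(n : ℝ))
      (b := fun n : ℕ => (n : ℝ)) C
      (fun n => ((hWc a ha).integrableOn_Icc (a := -(n : ℝ)) (b := (n : ℝ))).mono_set
        Set.Ioc_subset_Icc_self) hn' hn
      (Eventually.of_forall fun n => by
        simp only [norm_eq_abs, abs_of_nonneg (hW0 a ha _)]
        exact (hWint a ha _ _ (by linarith [(Nat.cast_nonneg n : (0 : ℝ) ≤ n)])).2)
  have hWeq : ∀ a ∈ S, ∀ x, W a x + ∑ b ∈ S, conv (W b) (KTwo b a) x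
      - ∑ p ∈ S, ρ p * KSite p a x = 0 := by
    intro a ha x
    have hlim := (((hW a ha x).add (tendsto_finsetSum S fun b hb' =>
      tendsto_conv (fun n => hvc (φ n) b hb') (fun n => hb (φ n) b hb') (hW b hb')
        (tame_KTwo b a) x)).sub_const (∑ p ∈ S, ρ p * KSite p a x)).abs
    exact abs_nonpos_iff.1 (le_of_tendsto_of_tendsto' hlim hεφ fun n => heq (φ n) a ha x)
  have hsi := tame_halfSech.integrable
  have hV := eq_zero_of_add_conv_eq_zero hpos (V := fun a x => W a x - ρ a * halfSech x)
    (fun a ha => (hWc a ha).sub (tame_halfSech.continuous.const_mul _))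
    (fun a ha => (hWi a ha).sub (hsi.const_mul _)) fun a ha x => by
      have h1 : ∀ b ∈ S, conv (fun x => W b x - ρ b * halfSech x) (KTwo b a) x =
          conv (W b) (KTwo b a) x - ρ b * conv halfSech (KTwo b a) x := by
        intro b hb'
        unfold conv
        simp only [sub_mul, mul_assoc]
        rw [integral_sub (integrable_mul_comp_sub (hWi b hb') (tame_KTwo b a) x)
          ((integrable_mul_comp_sub hsi (tame_KTwo b a) x).const_mul _), integral_const_mul]
      -- By `KSite_eq_conv`, the functions ρ_a s solve the limiting system exactly; W minus this
      -- solution is therefore a homogeneous solution.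
      have h2 : ∑ p ∈ S, ρ p * KSite p a x =
          ρ a * halfSech x + ∑ p ∈ S, ρ p * conv halfSech (KTwo p a) x := by
        rw [Finset.sum_congr rfl fun p hp => by
          rw [KSite_eq_conv (hpos p hp) (hpos a ha), mul_add], Finset.sum_add_distrib]
        simp [ha]
      have h3 := hWeq a ha x
      rw [h2] at h3
      rw [Finset.sum_congr rfl h1, Finset.sum_sub_distrib]
      linarith
  intro a ha x
  have := hV a ha x
  rw [← sub_eq_zero.1 this]
  exact hW a ha x

/-! ### Averaging of the remainder -/

/-- The ideal test function s'/s = -π tanh(πx) is not integrable; the regularised quotient is tame,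
and s times it approaches s' in L¹ as δ → 0. -/
theorem tame_deriv_halfSech_div {δ : ℝ} (hδ : 0 < δ) :
    Tame fun x => deriv halfSech x * (halfSech x + δ)⁻¹ := by
  have h0 : ∀ x, 0 < halfSech x + δ := fun x => by linarith [halfSech_pos x]
  have hd : ∀ x, HasDerivAt (fun x => (halfSech x + δ)⁻¹)
      (-deriv halfSech x / (halfSech x + δ) ^ 2) x := fun x =>
    ((tame_halfSech.hasDerivAt x).add_const δ).inv (h0 x).ne'
  obtain ⟨C, hC⟩ := tame_halfSech.bdd_deriv
  refine tame_deriv_halfSech.mul_bdd (C := δ⁻¹) (D := C / δ ^ 2) ?_ (fun x => ?_) fun x => ?_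
  · exact (tame_halfSech.contDiff.add contDiff_const).inv fun x => (h0 x).ne'
  · rw [abs_of_pos (inv_pos.2 (h0 x))]
    exact inv_anti₀ hδ (by linarith [halfSech_pos x])
  · rw [(hd x).deriv, abs_div, abs_neg, abs_of_pos (pow_pos (h0 x) 2)]
    exact div_le_div₀ ((abs_nonneg _).trans (hC 0)) (hC x) (by positivity)
      (pow_le_pow_left₀ hδ.le (by linarith [halfSech_pos x]) 2)

theorem tendsto_integral_abs_sub_halfSech :
    Tendsto (fun k : ℕ => ∫ x, |deriv halfSech x -
      halfSech x * (deriv halfSech x * (halfSech x + 1 / ((k : ℝ) + 1))⁻¹)|) atTop (𝓝 0) := by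
  have hk : ∀ k : ℕ, (0 : ℝ) < 1 / ((k : ℝ) + 1) := fun k => by positivity
  have hc := tame_halfSech.continuous
  have hc' := tame_deriv_halfSech.continuous
  have : (0 : ℝ) = ∫ _ : ℝ, (0 : ℝ) := by simp
  rw [this]
  refine tendsto_integral_of_dominated_convergence (fun x => |deriv halfSech x|) (fun k => ?_)
    tame_deriv_halfSech.integrable.abs (fun k => Eventually.of_forall fun x => ?_)
    (Eventually.of_forall fun x => ?_)
  · have h := (tame_deriv_halfSech_div (hk k)).continuous
    exact Continuous.aestronglyMeasurable (by fun_prop)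
  · have h0 := halfSech_pos x
    have h1 := hk k
    have h2 : deriv halfSech x - halfSech x * (deriv halfSech x * (halfSech x + 1 / ((k : ℝ) + 1))⁻¹)
        = deriv halfSech x * (1 / ((k : ℝ) + 1) / (halfSech x + 1 / ((k : ℝ) + 1))) := by
      have : halfSech x + 1 / ((k : ℝ) + 1) ≠ 0 := by positivity
      field_simp
      ring
    rw [norm_eq_abs, abs_abs, h2, abs_mul]
    refine mul_le_of_le_one_right (abs_nonneg _) ?_
    rw [abs_of_pos (by positivity), div_le_one (by positivity)]
    linarith
  · have h0 := halfSech_pos x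
    have h1 : Tendsto (fun k : ℕ => halfSech x + 1 / ((k : ℝ) + 1)) atTop (𝓝 (halfSech x + 0)) :=
      tendsto_one_div_add_atTop_nhds_zero_nat.const_add _
    rw [add_zero] at h1
    have h2 := (((h1.inv₀ h0.ne').const_mul (deriv halfSech x)).const_mul (halfSech x)).const_sub
      (deriv halfSech x) |>.abs
    have h3 : deriv halfSech x - halfSech x * (deriv halfSech x * (halfSech x)⁻¹) = 0 := by
      field_simp
      ring
    rwa [h3, abs_zero] at h2

/-- Since v tends to ρ s boundedly, v may be replaced by ρ s under the integral against g r, so ∫ s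
g r tends to 0 for tame g. Choosing g = s'/(s + δ) approximates s' at a cost controlled in L¹,
uniformly in n because r is bounded. -/
theorem tendsto_integral_deriv_halfSech_mul {r v : ℕ → ℝ → ℝ} {C ρ : ℝ} (hρ : 0 < ρ)
    (hr : ∀ n, Measurable (r n)) (hrb : ∀ n x, |r n x| ≤ 1 / 2) (hv : ∀ n, Continuous (v n))
    (hvb : ∀ n x, |v n x| ≤ C)
    (hlim : ∀ x, Tendsto (fun n => v n x) atTop (𝓝 (ρ * halfSech x)))
    (havg : ∀ g, Tame g → Tendsto (fun n => ∫ x, g x * r n x * v n x) atTop (𝓝 0)) :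
    Tendsto (fun n => ∫ x, deriv halfSech x * r n x) atTop (𝓝 0) := by
  have hmain : ∀ g, Tame g → Tendsto (fun n => ∫ x, halfSech x * g x * r n x) atTop (𝓝 0) := by
    intro g hg
    have hgc := hg.continuous
    have hsc := tame_halfSech.continuous
    have h1 : Tendsto (fun n => ∫ x, g x * r n x * (ρ * halfSech x - v n x)) atTop (𝓝 0) := by
      have : (0 : ℝ) = ∫ _ : ℝ, (0 : ℝ) := by simp
      rw [this]
      refine tendsto_integral_of_dominated_convergence (fun x => |g x| * (1 / 2 * (ρ + C)))
        (fun n => ?_) (hg.integrable.abs.mul_const _) (fun n => Eventually.of_forall fun x => ?_)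
        (Eventually.of_forall fun x => ?_)
      · have := hr n
        have := (hv n).measurable
        have := hgc.measurable
        have := hsc.measurable
        exact Measurable.aestronglyMeasurable (by fun_prop)
      · rw [norm_eq_abs, abs_mul, abs_mul, mul_assoc]
        refine mul_le_mul_of_nonneg_left ?_ (abs_nonneg _)
        refine mul_le_mul (hrb n x) ?_ (abs_nonneg _) (by norm_num)
        refine (abs_sub _ _).trans (add_le_add ?_ (hvb n x))
        rw [abs_of_pos (mul_pos hρ (halfSech_pos x))]
        nlinarith [halfSech_le x]
      · have h2 : Tendsto (fun n => |g x| * (1 / 2) * |ρ * halfSech x - v n x|) atTop (𝓝 0) := by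
          have := ((hlim x).const_sub (ρ * halfSech x)).abs.const_mul (|g x| * (1 / 2))
          simpa using this
        refine squeeze_zero_norm (fun n => ?_) h2
        rw [norm_eq_abs, abs_mul, abs_mul]
        exact mul_le_mul_of_nonneg_right
          (mul_le_mul_of_nonneg_left (hrb n x) (abs_nonneg _)) (abs_nonneg _)
    have h2 := ((havg g hg).add h1).const_mul ρ⁻¹
    simp only [add_zero, mul_zero] at h2
    refine h2.congr fun n => ?_
    have hgr : Integrable fun x => g x * r n x :=
      hg.integrable.mul_bdd (hr n).aestronglyMeasurable (Eventually.of_forall (hrb n))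
    rw [← integral_add (hgr.mul_bdd (hv n).aestronglyMeasurable (Eventually.of_forall (hvb n)))
      (hgr.mul_bdd (c := ρ + C) (by have := hv n; exact Continuous.aestronglyMeasurable (by fun_prop))
        (Eventually.of_forall fun x => by
          refine (abs_sub _ _).trans (add_le_add ?_ (hvb n x))
          rw [abs_of_pos (mul_pos hρ (halfSech_pos x))]
          nlinarith [halfSech_le x])), ← integral_const_mul]
    congr 1
    funext x
    field_simp
    ring
  rw [Metric.tendsto_atTop]
  intro ε hε
  obtain ⟨k, hk⟩ := ((tendsto_integral_abs_sub_halfSech).eventually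
    (gt_mem_nhds (show 0 < ε / 2 by linarith))).exists
  set g : ℝ → ℝ := fun x => deriv halfSech x * (halfSech x + 1 / ((k : ℝ) + 1))⁻¹ with hg
  have hgt : Tame g := tame_deriv_halfSech_div (by positivity)
  obtain ⟨N, hN⟩ := Metric.tendsto_atTop.1 (hmain g hgt) (ε / 2) (by linarith)
  refine ⟨N, fun n hn => ?_⟩
  have h1 := hN n hn
  rw [Real.dist_eq, sub_zero] at h1 ⊢
  have hsg : Integrable fun x => halfSech x * g x :=
    hgt.integrable.bdd_mul tame_halfSech.continuous.aestronglyMeasurable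
      (Eventually.of_forall fun x => by
        rw [norm_eq_abs, abs_of_pos (halfSech_pos x)]; exact halfSech_le x)
  have hdi := tame_deriv_halfSech.integrable
  have hmul : ∀ {f : ℝ → ℝ}, Integrable f → Integrable fun x => f x * r n x := fun hf =>
    hf.mul_bdd (hr n).aestronglyMeasurable (Eventually.of_forall (hrb n))
  have h2 : ∫ x, deriv halfSech x * r n x = (∫ x, halfSech x * g x * r n x) +
      ∫ x, (deriv halfSech x - halfSech x * g x) * r n x := by
    rw [← integral_add (hmul hsg) (hmul (f := fun x => deriv halfSech x - halfSech x * g x) (hdi.sub hsg))]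
    congr 1
    funext x
    ring
  have h3 : |∫ x, (deriv halfSech x - halfSech x * g x) * r n x| ≤
      ∫ x, |deriv halfSech x - halfSech x * g x| := by
    rw [← norm_eq_abs]
    refine norm_integral_le_of_norm_le (hdi.sub hsg).abs (Eventually.of_forall fun x => ?_)
    rw [norm_eq_abs, abs_mul]
    exact mul_le_of_le_one_right (abs_nonneg _) ((hrb n x).trans (by norm_num))
  rw [h2]
  refine (abs_add_le _ _).trans_lt ?_
  linarith

/-! ### Averages over the periodic chain -/

namespace Motif

variable (C : Motif)

theorem one_le_of_mem_spins {a : ℕ} (ha : a ∈ C.spins) : 1 ≤ a := by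
  obtain ⟨i, -, rfl⟩ := Finset.mem_image.1 ha
  exact C.twoSpin_pos i

theorem L₀_cast_pos : (0 : ℝ) < C.L₀ := by exact_mod_cast C.L₀_pos

theorem rho_pos {a : ℕ} (ha : a ∈ C.spins) : 0 < C.rho a := by
  obtain ⟨i, -, rfl⟩ := Finset.mem_image.1 ha
  refine div_pos ?_ C.L₀_cast_pos
  exact_mod_cast Finset.card_pos.2 ⟨i, by simp⟩

theorem sum_twoSpin (f : ℕ → ℝ) : ∑ i, f (C.twoSpin i) = C.L₀ * ∑ s ∈ C.spins, C.rho s * f s := by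
  have h0 := C.L₀_cast_pos.ne'
  rw [Finset.mul_sum, ← Finset.sum_fiberwise_of_maps_to (s := Finset.univ) (t := C.spins)
    (g := C.twoSpin) fun i _ => Finset.mem_image_of_mem _ (Finset.mem_univ i)]
  refine Finset.sum_congr rfl fun s _ => ?_
  rw [Finset.sum_congr rfl fun i hi => by rw [(Finset.mem_filter.1 hi).2], Finset.sum_const,
    nsmul_eq_mul, rho]
  field_simp

theorem sum_siteSpin (f : ℕ → ℝ) {L : ℕ} (hL : C.L₀ ∣ L) :
    ∑ j ∈ Finset.range L, f (C.siteSpin j) = L * ∑ s ∈ C.spins, C.rho s * f s := by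
  obtain ⟨k, rfl⟩ := hL
  have h1 : ∑ j ∈ Finset.range C.L₀, f (C.siteSpin j) = ∑ i, f (C.twoSpin i) := by
    rw [Finset.sum_range]
    refine Finset.sum_congr rfl fun i _ => ?_
    simp only [siteSpin, Nat.mod_eq_of_lt i.2]
  have h2 : ∀ m j, C.siteSpin (C.L₀ * m + j) = C.siteSpin j := by
    intro m j
    simp only [siteSpin, Nat.mul_add_mod]
  rw [Nat.cast_mul, mul_comm (C.L₀ : ℝ), mul_assoc, ← C.sum_twoSpin]
  induction k with
  | zero => simp
  | succ k ih =>
    rw [mul_add, mul_one, Finset.sum_range_add, ih]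
    simp only [h2]
    rw [h1]
    push_cast
    ring

end Motif

/-! ### From Bethe states to counting profiles and the energy identity -/

namespace BetheState

variable {C : Motif} {X : Excitation C} {L : ℕ} (B : BetheState C X L)

theorem one_le_of_mem_support {b : ℕ} (hb : b ∈ B.ν.support) : 1 ≤ b := by
  rcases Nat.eq_zero_or_pos b with rfl | h
  · have h0 : 0 ∉ C.spins := fun h => absurd (C.one_le_of_mem_spins h) (by norm_num)
    rw [Finsupp.mem_support_iff, B.ν_new 0 h0, X.newStrings_pos] at hb
    exact absurd rfl hb
  · exact h

theorem sum_support_eq (F : (b : ℕ) → Fin (B.ν b) → ℝ) :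
    ∑ b ∈ B.ν.support, ∑ l, F b l =
      ∑ b ∈ C.spins, ∑ l, F b l + ∑ b ∈ X.newStrings.support, ∑ l, F b l := by
  rw [← Finset.sum_union]
  · refine Finset.sum_subset (fun b hb => ?_) fun b _ hb => ?_
    · rw [Finset.mem_union]
      by_cases h : b ∈ C.spins
      · exact Or.inl h
      · rw [Finsupp.mem_support_iff, B.ν_new b h] at hb
        exact Or.inr (Finsupp.mem_support_iff.2 hb)
    · have : IsEmpty (Fin (B.ν b)) := by
        rw [Finsupp.notMem_support_iff.1 hb]; infer_instance
      simp
  · refine Finset.disjoint_left.2 fun b hb hb' => ?_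
    exact Finsupp.mem_support_iff.1 hb' (X.newStrings_spins b hb)

theorem ν_of_mem_newStrings {b : ℕ} (hb : b ∈ X.newStrings.support) : B.ν b = X.newStrings b :=
  B.ν_new b fun h => Finsupp.mem_support_iff.1 hb (X.newStrings_spins b h)

theorem sum_support_ite (a : ℕ) (F : (b : ℕ) → Fin (B.ν b) → ℝ) :
    ∑ b ∈ B.ν.support, ∑ l, (if a = b then F b l else 0) = ∑ l, F a l := by
  by_cases ha : a ∈ B.ν.support
  · rw [Finset.sum_eq_single_of_mem a ha fun b _ hb => by simp [hb.symm]]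
    simp
  · have : IsEmpty (Fin (B.ν a)) := by
      rw [Finsupp.notMem_support_iff.1 ha]; infer_instance
    rw [Finset.univ_eq_empty, Finset.sum_empty]
    refine Finset.sum_eq_zero fun b hb => Finset.sum_eq_zero fun l _ => if_neg ?_
    rintro rfl
    exact ha hb

/-- Written so that each summand is the limit of a phase at +∞ divided by π; the counting function
then tends to ±π times the valence. -/
theorem valence_eq (a : ℕ) : (C.valence L B.ν a : ℝ) =
    L * ∑ s ∈ C.spins, C.rho s * (min s a : ℕ) -
      ∑ b ∈ B.ν.support, ∑ _l : Fin (B.ν b), (2 * ((min b a : ℕ) : ℝ) - if b = a then 1 else 0) := by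
  have h1 := C.sum_siteSpin (fun s => ((min s a : ℕ) : ℝ)) B.dvd
  have h2 := B.sum_support_ite a fun _ _ => (1 : ℝ)
  simp only [Finset.sum_const, Finset.card_univ, Fintype.card_fin, nsmul_eq_mul, mul_one] at h2
  rw [← h1]
  unfold Motif.valence
  simp only [Finset.sum_const, Finset.card_univ, Fintype.card_fin, nsmul_eq_mul, mul_sub,
    Finset.sum_sub_distrib]
  simp only [eq_comm (b := a)]
  rw [h2]
  push_cast
  simp only [min_comm (a : ℝ)]
  rw [Finset.mul_sum]
  have : ∀ b ∈ B.ν.support, 2 * (min (b : ℝ) a * (B.ν b : ℝ)) = B.ν b * (2 * min (b : ℝ) a) :=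
    fun b _ => by ring
  rw [Finset.sum_congr rfl this]
  ring

theorem hasDerivAt_counting {a : ℕ} (ha : 1 ≤ a) (x : ℝ) :
    HasDerivAt (C.counting L B.ν B.center a)
      (2 * π * (L * ∑ s ∈ C.spins, C.rho s * KSite s a x
        - ∑ b ∈ B.ν.support, ∑ l, KTwo b a (x - B.center b l))) x := by
  have h1 := (HasDerivAt.fun_sum fun s (_ : s ∈ C.spins) =>
    (hasDerivAt_PhiSite (a := s) ha x).const_mul (C.rho s)).const_mul (L : ℝ)
  have h2 := HasDerivAt.fun_sum fun b (hb : b ∈ B.ν.support) =>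
    HasDerivAt.fun_sum fun l (_ : l ∈ (Finset.univ : Finset (Fin (B.ν b)))) =>
      (hasDerivAt_PhiTwo (B.one_le_of_mem_support hb) ha (x - B.center b l)).comp_sub_const x
        (B.center b l)
  refine (h1.sub h2).congr_deriv ?_
  simp only [mul_sub, Finset.mul_sum]
  congr 1
  refine Finset.sum_congr rfl fun s _ => ?_
  ring

theorem counting_tendsto {l : Filter ℝ} {σ : ℝ} {a : ℕ}
    (h1 : ∀ s, Tendsto (PhiSite s a) l (𝓝 (σ * (min s a : ℕ))))
    (h2 : ∀ b, 1 ≤ b → ∀ c, Tendsto (fun x => PhiTwo b a (x - c)) l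
      (𝓝 (σ * (2 * (min b a : ℕ) - if b = a then 1 else 0)))) :
    Tendsto (C.counting L B.ν B.center a) l (𝓝 (σ * C.valence L B.ν a)) := by
  have h3 := ((tendsto_finsetSum C.spins fun s _ => (h1 s).const_mul (C.rho s)).const_mul (L : ℝ)).sub
    (tendsto_finsetSum B.ν.support fun b hb =>
      tendsto_finsetSum (Finset.univ : Finset (Fin (B.ν b))) fun l _ =>
        h2 b (B.one_le_of_mem_support hb) (B.center b l))
  have e : σ * (C.valence L B.ν a : ℝ) = L * ∑ s ∈ C.spins, C.rho s * (σ * (min s a : ℕ)) -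
      ∑ b ∈ B.ν.support, ∑ _l : Fin (B.ν b),
        σ * (2 * ((min b a : ℕ) : ℝ) - if b = a then 1 else 0) := by
    rw [valence_eq, mul_sub, Finset.mul_sum, Finset.mul_sum, Finset.mul_sum, Finset.mul_sum]
    congr 1
    · exact Finset.sum_congr rfl fun s _ => by ring
    · exact Finset.sum_congr rfl fun b _ => Finset.mul_sum _ _ _
  rw [e]
  exact h3

theorem counting_tendsto_atTop {a : ℕ} (ha : 1 ≤ a) :
    Tendsto (C.counting L B.ν B.center a) atTop (𝓝 (π * C.valence L B.ν a)) :=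
  B.counting_tendsto (fun _ => PhiSite_tendsto_atTop ha) fun _ hb c =>
    (PhiTwo_tendsto_atTop hb ha).comp
      (by simpa only [sub_eq_add_neg, id] using tendsto_atTop_add_const_right atTop (-c) tendsto_id)

theorem counting_tendsto_atBot {a : ℕ} (ha : 1 ≤ a) :
    Tendsto (C.counting L B.ν B.center a) atBot (𝓝 (-π * C.valence L B.ν a)) := by
  have hneg : ∀ {f : ℝ → ℝ} {l : ℝ}, (∀ x, f (-x) = -f x) → Tendsto f atTop (𝓝 (π * l)) →
      Tendsto f atBot (𝓝 (-π * l)) := by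
    intro f l hf h
    have := (h.comp tendsto_neg_atBot_atTop).neg
    simpa [Function.comp_def, hf] using this
  exact B.counting_tendsto (fun s => hneg (PhiSite_neg s a) (PhiSite_tendsto_atTop ha))
    fun b hb c => (hneg (PhiTwo_neg b a) (PhiTwo_tendsto_atTop hb ha)).comp
      (by simpa only [sub_eq_add_neg, id] using tendsto_atBot_add_const_right atBot (-c) tendsto_id)

/-- The normalised derivative of the counting function. -/
def density (a : ℕ) (x : ℝ) : ℝ :=
  L * ∑ s ∈ C.spins, C.rho s * KSite s a x - ∑ b ∈ B.ν.support, ∑ l, KTwo b a (x - B.center b l)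

theorem continuous_density (a : ℕ) : Continuous (B.density a) := by
  have h1 : ∀ s, Continuous (KSite s a) := fun s => (tame_KSite s a).continuous
  have h2 : ∀ b, Continuous (KTwo b a) := fun b => (tame_KTwo b a).continuous
  unfold density
  fun_prop

theorem mem_allowed_of_sum (a : ℕ) (j : Fin (B.ν a) ⊕ Fin (B.numHoles a)) (ha : a ∈ C.spins) :
    Sum.elim (B.Q a) (B.holeQ a) j ∈ C.allowed L B.ν a := by
  cases j with
  | inl k => exact B.Q_allowed a k
  | inr d =>
    have : B.holeQ a d ∈ C.allowed L B.ν a \ Set.range (B.Q a) := by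
      rw [← B.holeQ_range a ha]; exact ⟨d, rfl⟩
    exact this.1

theorem sum_elim_injective {a : ℕ} (ha : a ∈ C.spins) :
    Function.Injective (Sum.elim (B.Q a) (B.holeQ a)) := by
  refine (B.Q_injective a).sumElim (B.holeQ_injective a ha) fun k d h => ?_
  have : B.holeQ a d ∈ C.allowed L B.ν a \ Set.range (B.Q a) := by
    rw [← B.holeQ_range a ha]; exact ⟨d, rfl⟩
  exact this.2 ⟨k, h⟩

theorem mem_range_sum_elim {a : ℕ} (ha : a ∈ C.spins) {q : ℝ} (hq : q ∈ C.allowed L B.ν a) :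
    ∃ j, Sum.elim (B.Q a) (B.holeQ a) j = q := by
  by_cases h : q ∈ Set.range (B.Q a)
  · obtain ⟨k, rfl⟩ := h
    exact ⟨Sum.inl k, rfl⟩
  · have : q ∈ Set.range (B.holeQ a) := by rw [B.holeQ_range a ha]; exact ⟨hq, h⟩
    obtain ⟨d, rfl⟩ := this
    exact ⟨Sum.inr d, rfl⟩

/-- The profile of the sea of strings of length `a`; the enumerated points are the centers and
the holes. -/
theorem exists_profile {a : ℕ} (ha : a ∈ C.spins) (hP : 0 ≤ C.valence L B.ν a) :
    ∃ D : CountingProfile (Fin (B.ν a) ⊕ Fin (B.numHoles a)),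
      D.pt = Sum.elim (B.center a) (B.hole a) ∧ deriv D.u = B.density a ∧
      (D.P : ℝ) = C.valence L B.ν a := by
  have ha1 := C.one_le_of_mem_spins ha
  have hp := pi_pos
  obtain ⟨P, hPP⟩ := Int.eq_ofNat_of_zero_le hP
  have hPr : (C.valence L B.ν a : ℝ) = P := by rw [hPP]; simp
  -- The shift by P/2 sends the quantum number (1 - P)/2 + i to the level i + 1/2.
  set u : ℝ → ℝ := fun x => C.counting L B.ν B.center a x / (2 * π) + P / 2 with hu
  have hd : ∀ x, HasDerivAt u (B.density a x) x := by
    intro x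
    refine (((B.hasDerivAt_counting ha1 x).div_const (2 * π)).add_const (P / 2 : ℝ)).congr_deriv ?_
    rw [mul_div_cancel_left₀ _ (by positivity : 2 * π ≠ 0), density]
  have hdu : deriv u = B.density a := funext fun x => (hd x).deriv
  choose lab hlab hlabq using fun j => B.mem_allowed_of_sum a j ha
  have hupt : ∀ j, u (Sum.elim (B.center a) (B.hole a) j) = lab j + 1 / 2 := by
    intro j
    have h : C.counting L B.ν B.center a (Sum.elim (B.center a) (B.hole a) j) =
        2 * π * Sum.elim (B.Q a) (B.holeQ a) j := by
      cases j with
      | inl k => exact B.bethe a k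
      | inr d => exact B.hole_eq a ha d
    simp only [hu]
    rw [h, mul_div_cancel_left₀ _ (by positivity : 2 * π ≠ 0), hlabq, hPr]
    ring
  refine ⟨{
    P := P
    u := u
    pt := Sum.elim (B.center a) (B.hole a)
    label := lab
    u_pt := hupt
    contDiff := ?_
    bdd_deriv := ?_
    tendsto_atBot := ?_
    tendsto_atTop := ?_
    unique := ?_
    label_injective := ?_
    range_label := ?_ }, rfl, hdu, hPr.symm⟩
  · rw [contDiff_one_iff_deriv, hdu]
    exact ⟨fun x => (hd x).differentiableAt, B.continuous_density a⟩
  · rw [hdu]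
    have h1 : ∀ s, ∃ M, ∀ x, |KSite s a x| ≤ M := fun s => (tame_KSite s a).bdd
    have h2 : ∀ b, ∃ M, ∀ x, |KTwo b a x| ≤ M := fun b => (tame_KTwo b a).bdd
    choose M hM using h1
    choose N hN using h2
    refine ⟨L * ∑ s ∈ C.spins, |C.rho s| * M s + ∑ b ∈ B.ν.support, ∑ _l : Fin (B.ν b), N b,
      fun x => ?_⟩
    refine (abs_sub _ _).trans (add_le_add ?_ ?_)
    · rw [abs_mul, Nat.abs_cast]
      refine mul_le_mul_of_nonneg_left ((Finset.abs_sum_le_sum_abs _ _).trans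
        (Finset.sum_le_sum fun s _ => ?_)) (Nat.cast_nonneg _)
      rw [abs_mul]
      exact mul_le_mul_of_nonneg_left (hM s x) (abs_nonneg _)
    · exact (Finset.abs_sum_le_sum_abs _ _).trans (Finset.sum_le_sum fun b _ =>
        (Finset.abs_sum_le_sum_abs _ _).trans (Finset.sum_le_sum fun l _ => hN b _))
  · have := ((B.counting_tendsto_atBot ha1).div_const (2 * π)).add_const (P / 2 : ℝ)
    convert this using 2
    rw [hPr]
    field_simp
    ring
  · have := ((B.counting_tendsto_atTop ha1).div_const (2 * π)).add_const (P / 2 : ℝ)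
    convert this using 2
    rw [hPr]
    field_simp
    ring
  · intro i x y hx hy
    have key : ∀ z, u z = i + 1 / 2 → C.counting L B.ν B.center a z =
        2 * π * ((1 - (C.valence L B.ν a : ℝ)) / 2 + i) := by
      intro z hz
      simp only [hu] at hz
      rw [hPr]
      field_simp at hz
      linarith
    exact B.unique a ha i x y (key x hx) (key y hy)
  · intro j k h
    refine B.sum_elim_injective ha ?_
    rw [hlabq, hlabq, h]
  · intro i
    constructor
    · rintro ⟨j, rfl⟩
      have := hlab j
      omega
    · intro hi
      obtain ⟨j, hj⟩ := B.mem_range_sum_elim ha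
        (q := (1 - (C.valence L B.ν a : ℝ)) / 2 + i) ⟨i, by omega, rfl⟩
      refine ⟨j, ?_⟩
      rw [hlabq] at hj
      have : (lab j : ℝ) = i := by linarith
      exact_mod_cast this

theorem excitationEnergy_eq (a : ℕ) :
    B.excitationEnergy a = 2 * π * ∑ d, halfSech (B.hole a d) := by
  rw [excitationEnergy, Finset.mul_sum]
  refine Finset.sum_congr rfl fun d _ => ?_
  have := cosh_pos (π * B.hole a d)
  rw [halfSech]
  field_simp

theorem sum_pt_eq {a : ℕ} {D : CountingProfile (Fin (B.ν a) ⊕ Fin (B.numHoles a))}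
    (hD : D.pt = Sum.elim (B.center a) (B.hole a)) (f : ℝ → ℝ) :
    ∑ j, f (D.pt j) = ∑ k, f (B.center a k) + ∑ d, f (B.hole a d) := by
  rw [hD, Fintype.sum_sum_type]
  simp

/-- The finite-size correction to the energy, in closed form. -/
theorem energy_sub_eq {a : ℕ} (ha : a ∈ C.spins)
    {D : CountingProfile (Fin (B.ν a) ⊕ Fin (B.numHoles a))}
    (hD : D.pt = Sum.elim (B.center a) (B.hole a)) (hu : deriv D.u = B.density a) :
    B.energy a - (L * C.vacuumEnergy a + B.excitationEnergy a) =
      -(2 * π) * ∫ x, deriv halfSech x * D.rem x := by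
  have ha1 := C.one_le_of_mem_spins ha
  have hsi := tame_halfSech.integrable
  have hsum := D.sum_pt_eq tame_halfSech
  rw [B.sum_pt_eq hD, hu] at hsum
  -- Only strings of length a receive the bare term s; all others enter through the convolution
  -- alone.
  have hE : B.energy a = -(2 * π) * (∑ k, halfSech (B.center a k) +
      ∑ b ∈ B.ν.support, ∑ l, conv halfSech (KTwo a b) (B.center b l)) := by
    rw [energy, ← B.sum_support_ite a fun b l => halfSech (B.center b l), ← Finset.sum_add_distrib,
      neg_mul, Finset.mul_sum]
    congr 1
    refine Finset.sum_congr rfl fun b hb => ?_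
    rw [← Finset.sum_add_distrib, Finset.mul_sum]
    refine Finset.sum_congr rfl fun l _ => ?_
    rw [PsiSite_eq (B.one_le_of_mem_support hb),
      KSite_eq_conv ha1 (B.one_le_of_mem_support hb)]
  have hconv : ∀ b l, conv halfSech (KTwo a b) (B.center b l) =
      ∫ y, halfSech y * KTwo b a (y - B.center b l) := by
    intro b l
    unfold conv
    congr 1
    funext y
    rw [← KTwo_neg, neg_sub, KTwo_comm]
  have hi1 : ∀ s, Integrable fun y => halfSech y * KSite s a y := fun s => by
    obtain ⟨M, hM⟩ := (tame_KSite s a).bdd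
    exact hsi.mul_bdd (tame_KSite s a).continuous.aestronglyMeasurable (Eventually.of_forall hM)
  have hi2 : ∀ b (l : Fin (B.ν b)), Integrable fun y => halfSech y * KTwo b a (y - B.center b l) := by
    intro b l
    obtain ⟨M, hM⟩ := (tame_KTwo b a).bdd
    have hc := (tame_KTwo b a).continuous
    exact hsi.mul_bdd (by fun_prop) (Eventually.of_forall fun y => hM _)
  have hint : ∫ y, halfSech y * B.density a y =
      L * ∑ s ∈ C.spins, C.rho s * (∫ y, halfSech y * KSite s a y) -
      ∑ b ∈ B.ν.support, ∑ l, ∫ y, halfSech y * KTwo b a (y - B.center b l) := by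
    have h1 : ∀ y, halfSech y * B.density a y =
        (∑ s ∈ C.spins, (L * C.rho s) * (halfSech y * KSite s a y)) -
          ∑ b ∈ B.ν.support, ∑ l, halfSech y * KTwo b a (y - B.center b l) := by
      intro y
      rw [density, mul_sub]
      simp only [Finset.mul_sum]
      congr 1
      exact Finset.sum_congr rfl fun s _ => by ring
    simp only [h1]
    rw [integral_sub (integrable_finsetSum _ fun s _ => (hi1 s).const_mul _)
      (integrable_finsetSum _ fun b _ => integrable_finsetSum _ fun l _ => hi2 b l),
      integral_finsetSum _ fun s _ => (hi1 s).const_mul _,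
      integral_finsetSum _ fun b _ => integrable_finsetSum _ fun l _ => hi2 b l]
    congr 1
    · rw [Finset.mul_sum]
      refine Finset.sum_congr rfl fun s _ => ?_
      rw [integral_const_mul]
      ring
    · exact Finset.sum_congr rfl fun b _ => integral_finsetSum _ fun l _ => hi2 b l
  have hvac : C.vacuumEnergy a =
      -(2 * π) * ∑ s ∈ C.spins, C.rho s * ∫ y, halfSech y * KSite s a y := by
    rw [vacuumEnergy_eq, neg_mul, Finset.mul_sum]
    congr 1
    exact Finset.sum_congr rfl fun s _ => by ring
  simp only [hconv] at hE
  rw [hE, hvac, excitationEnergy_eq]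
  -- The sums of string-string terms over all centers cancel between the energy and ∫ s·density,
  -- leaving the vacuum, the holes and the remainder.
  linear_combination (-(2 * π)) * hsum + (-(2 * π)) * hint

end BetheState

/-! ### Estimates uniform in the length and in the state -/

theorem exists_common_bound {ι : Type*} (s : Finset ι) {p : ι → ℝ → Prop}
    (hmono : ∀ i x y, x ≤ y → p i x → p i y) (h : ∀ i, ∃ x, p i x) :
    ∃ M, 0 ≤ M ∧ ∀ i ∈ s, p i M := by
  choose x hx using h
  refine ⟨∑ i ∈ s, |x i|, Finset.sum_nonneg fun i _ => abs_nonneg _, fun i hi => ?_⟩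
  exact hmono i _ _ ((le_abs_self _).trans
    (Finset.single_le_sum (f := fun i => |x i|) (fun i _ => abs_nonneg _) hi)) (hx i)

/-- `M` bounds the kernels with given indices, their Lipschitz constants and their variation. -/
structure KernelBound (b a : ℕ) (M : ℝ) : Prop where
  two : ∀ x, |KTwo b a x| ≤ M
  two_sub : ∀ x y, |KTwo b a x - KTwo b a y| ≤ M * |x - y|
  site : ∀ x, |KSite b a x| ≤ M
  site_sub : ∀ x y, |KSite b a x - KSite b a y| ≤ M * |x - y|
  variation : ∫ x, |deriv (KTwo b a) x| ≤ M

theorem KernelBound.mono {b a : ℕ} {M N : ℝ} (h : M ≤ N) (hM : KernelBound b a M) :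
    KernelBound b a N where
  two x := (hM.two x).trans h
  two_sub x y := (hM.two_sub x y).trans (mul_le_mul_of_nonneg_right h (abs_nonneg _))
  site x := (hM.site x).trans h
  site_sub x y := (hM.site_sub x y).trans (mul_le_mul_of_nonneg_right h (abs_nonneg _))
  variation := hM.variation.trans h

theorem exists_kernelBound (b a : ℕ) : ∃ M, KernelBound b a M := by
  obtain ⟨M₁, h₁⟩ := (tame_KTwo b a).bdd
  obtain ⟨M₂, -, h₂⟩ := (tame_KTwo b a).lipschitz
  obtain ⟨M₃, h₃⟩ := (tame_KSite b a).bdd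
  obtain ⟨M₄, -, h₄⟩ := (tame_KSite b a).lipschitz
  set M := max M₁ (max M₂ (max M₃ (max M₄ (∫ x, |deriv (KTwo b a) x|))))
  have l₁ : M₁ ≤ M := le_max_left _ _
  have l₂ : M₂ ≤ M := le_max_of_le_right (le_max_left _ _)
  have l₃ : M₃ ≤ M := le_max_of_le_right (le_max_of_le_right (le_max_left _ _))
  have l₄ : M₄ ≤ M :=
    le_max_of_le_right (le_max_of_le_right (le_max_of_le_right (le_max_left _ _)))
  have l₅ : ∫ x, |deriv (KTwo b a) x| ≤ M :=
    le_max_of_le_right (le_max_of_le_right (le_max_of_le_right (le_max_right _ _)))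
  exact ⟨M, fun x => (h₁ x).trans l₁,
    fun x y => (h₂ x y).trans (mul_le_mul_of_nonneg_right l₂ (abs_nonneg _)),
    fun x => (h₃ x).trans l₃,
    fun x y => (h₄ x y).trans (mul_le_mul_of_nonneg_right l₄ (abs_nonneg _)), l₅⟩

theorem exists_uniform_kernelBound (s t : Finset ℕ) :
    ∃ M, 0 ≤ M ∧ ∀ b ∈ s, ∀ a ∈ t, KernelBound b a M := by
  obtain ⟨M, hM0, hM⟩ := exists_common_bound (s ×ˢ t) (p := fun i => KernelBound i.1 i.2)
    (fun _ _ _ h => KernelBound.mono h) fun i => exists_kernelBound i.1 i.2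
  exact ⟨M, hM0, fun b hb a ha => hM (b, a) (Finset.mk_mem_product hb ha)⟩

/-- The number of holes in the sea of strings of length `a`. -/
def holeCount (C : Motif) (X : Excitation C) (a : ℕ) : ℝ :=
  2 * ∑ b ∈ C.spins, ((min b a : ℕ) : ℝ) * X.removed b
    - 2 * ∑ b ∈ X.newStrings.support, ((min b a : ℕ) : ℝ) * X.newStrings b

namespace BetheState

variable {C : Motif} {X : Excitation C} {L : ℕ} (B : BetheState C X L)

/-- The terms proportional to L cancel because the seas hold Lρ_b/2 - μ_b strings; so the number of
holes is fixed by the configuration. -/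
theorem valence_sub_eq (a : ℕ) :
    (C.valence L B.ν a : ℝ) - B.ν a = holeCount C X a := by
  have h1 := B.sum_support_ite a fun _ _ => (1 : ℝ)
  have h2 := B.sum_support_eq fun b _ => 2 * ((min b a : ℕ) : ℝ)
  rw [B.valence_eq]
  simp only [Finset.sum_sub_distrib, eq_comm (b := a)]
  rw [h1, h2]
  simp only [Finset.sum_const, Finset.card_univ, Fintype.card_fin, nsmul_eq_mul, mul_one]
  have h3 : ∑ b ∈ C.spins, (B.ν b : ℝ) * (2 * ((min b a : ℕ) : ℝ)) =
      L * ∑ s ∈ C.spins, C.rho s * (min s a : ℕ)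
        - 2 * ∑ b ∈ C.spins, ((min b a : ℕ) : ℝ) * X.removed b := by
    rw [Finset.mul_sum, Finset.mul_sum, ← Finset.sum_sub_distrib]
    refine Finset.sum_congr rfl fun b hb => ?_
    rw [B.ν_sea b hb]
    ring
  have h4 : ∑ b ∈ X.newStrings.support, (B.ν b : ℝ) * (2 * ((min b a : ℕ) : ℝ)) =
      2 * ∑ b ∈ X.newStrings.support, ((min b a : ℕ) : ℝ) * X.newStrings b := by
    rw [Finset.mul_sum]
    refine Finset.sum_congr rfl fun b hb => ?_
    rw [B.ν_of_mem_newStrings hb]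
    ring
  rw [h3, h4, holeCount]
  ring

theorem numHoles_le (a : ℕ) : (B.numHoles a : ℝ) ≤ |holeCount C X a| := by
  have h1 : ((B.numHoles a : ℕ) : ℤ) ≤ |C.valence L B.ν a - B.ν a| := by
    rw [numHoles]
    rcases abs_cases (C.valence L B.ν a - B.ν a) with h | h <;> omega
  have h2 : ((B.numHoles a : ℤ) : ℝ) ≤ ((|C.valence L B.ν a - B.ν a| : ℤ) : ℝ) := by
    exact_mod_cast h1
  rw [← B.valence_sub_eq a]
  push_cast at h2
  exact h2

theorem sum_ν_le (hL : 1 ≤ L) : ∑ b ∈ B.ν.support, (B.ν b : ℝ) ≤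
    L * (∑ b ∈ C.spins, (C.rho b + |(X.removed b : ℝ)|)
      + ∑ b ∈ X.newStrings.support, (X.newStrings b : ℝ)) := by
  have hL' : (1 : ℝ) ≤ L := by exact_mod_cast hL
  have h := B.sum_support_eq fun _ _ => (1 : ℝ)
  simp only [Finset.sum_const, Finset.card_univ, Fintype.card_fin, nsmul_eq_mul, mul_one] at h
  rw [h, mul_add, Finset.mul_sum, Finset.mul_sum]
  refine add_le_add (Finset.sum_le_sum fun b hb => ?_) (Finset.sum_le_sum fun b hb => ?_)
  · rw [B.ν_sea b hb]
    have h0 := (C.rho_pos hb).le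
    have h1 : -(X.removed b : ℝ) ≤ |(X.removed b : ℝ)| := neg_le_abs _
    nlinarith [abs_nonneg (X.removed b : ℝ), mul_nonneg (by linarith : (0 : ℝ) ≤ L) h0]
  · rw [B.ν_of_mem_newStrings hb]
    exact le_mul_of_one_le_left (Nat.cast_nonneg _) hL'

theorem abs_linear_le {G : ℕ → ℝ} {H : (b : ℕ) → Fin (B.ν b) → ℝ} {M : ℝ}
    (hG : ∀ s ∈ C.spins, |G s| ≤ M) (hH : ∀ b ∈ B.ν.support, ∀ l, |H b l| ≤ M) :
    |L * ∑ s ∈ C.spins, C.rho s * G s - ∑ b ∈ B.ν.support, ∑ l, H b l| ≤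
      (L * ∑ s ∈ C.spins, C.rho s + ∑ b ∈ B.ν.support, (B.ν b : ℝ)) * M := by
  rw [add_mul, mul_assoc, Finset.sum_mul, Finset.sum_mul]
  refine (abs_sub _ _).trans (add_le_add ?_ ?_)
  · rw [abs_mul, Nat.abs_cast]
    refine mul_le_mul_of_nonneg_left ((Finset.abs_sum_le_sum_abs _ _).trans
      (Finset.sum_le_sum fun s hs => ?_)) (Nat.cast_nonneg _)
    rw [abs_mul, abs_of_pos (C.rho_pos hs)]
    exact mul_le_mul_of_nonneg_left (hG s hs) (C.rho_pos hs).le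
  · refine (Finset.abs_sum_le_sum_abs _ _).trans (Finset.sum_le_sum fun b hb =>
      (Finset.abs_sum_le_sum_abs _ _).trans ((Finset.sum_le_sum fun l _ => hH b hb l).trans ?_))
    simp

theorem mem_of_mem_support {b : ℕ} (hb : b ∈ B.ν.support) :
    b ∈ C.spins ∪ X.newStrings.support := by
  rw [Finset.mem_union]
  by_cases h : b ∈ C.spins
  · exact Or.inl h
  · rw [Finsupp.mem_support_iff, B.ν_new b h] at hb
    exact Or.inr (Finsupp.mem_support_iff.2 hb)

theorem abs_density_le {a : ℕ} {M : ℝ}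
    (hM : ∀ b ∈ C.spins ∪ X.newStrings.support, KernelBound b a M) (x : ℝ) :
    |B.density a x| ≤ (L * ∑ s ∈ C.spins, C.rho s + ∑ b ∈ B.ν.support, (B.ν b : ℝ)) * M :=
  B.abs_linear_le (fun s hs => (hM s (Finset.mem_union_left _ hs)).site x)
    fun b hb _ => (hM b (B.mem_of_mem_support hb)).two _

theorem abs_density_sub_le {a : ℕ} {M : ℝ}
    (hM : ∀ b ∈ C.spins ∪ X.newStrings.support, KernelBound b a M) (x y : ℝ) :
    |B.density a x - B.density a y| ≤
      (L * ∑ s ∈ C.spins, C.rho s + ∑ b ∈ B.ν.support, (B.ν b : ℝ)) * (M * |x - y|) := by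
  have h : B.density a x - B.density a y =
      L * ∑ s ∈ C.spins, C.rho s * (KSite s a x - KSite s a y) -
        ∑ b ∈ B.ν.support, ∑ l,
          (KTwo b a (x - B.center b l) - KTwo b a (y - B.center b l)) := by
    simp only [density, mul_sub, Finset.sum_sub_distrib]
    ring
  rw [h]
  refine B.abs_linear_le (fun s hs => (hM s (Finset.mem_union_left _ hs)).site_sub x y)
    fun b hb l => ?_
  have := (hM b (B.mem_of_mem_support hb)).two_sub (x - B.center b l) (y - B.center b l)
  rwa [sub_sub_sub_cancel_right] at this

/-- Replacing the sum over a sea by an integral against its density costs a remainder term, bounded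
by the variation of the kernel, and the holes, whose number does not grow with L. -/
theorem abs_sum_center_sub_conv_le {a b : ℕ} (hb : b ∈ C.spins) (hP : 0 ≤ C.valence L B.ν b)
    {M : ℝ} (hM : KernelBound b a M) (x : ℝ) :
    |∑ l, KTwo b a (x - B.center b l) - conv (B.density b) (KTwo b a) x| ≤
      M + |holeCount C X b| * M := by
  obtain ⟨D, hpt, hu, -⟩ := B.exists_profile hb hP
  have hf := (tame_KTwo b a).comp_sub_left x
  have h1 := D.sum_pt_eq hf
  have h2 := B.sum_pt_eq hpt fun y => KTwo b a (x - y)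
  rw [h2, hu] at h1
  have h3 : ∫ t, KTwo b a (x - t) * B.density b t = conv (B.density b) (KTwo b a) x := by
    unfold conv
    simp only [mul_comm]
  have h4 := D.abs_integral_mul_rem_le hf.integrable_deriv
  rw [Tame.integral_abs_deriv_comp_sub_left] at h4
  have hM0 : 0 ≤ M := (abs_nonneg _).trans (hM.two 0)
  have h5 : |∑ d, KTwo b a (x - B.hole b d)| ≤ |holeCount C X b| * M := by
    refine (Finset.abs_sum_le_sum_abs _ _).trans
      ((Finset.sum_le_sum fun d _ => hM.two _).trans ?_)
    simp only [Finset.sum_const, Finset.card_univ, Fintype.card_fin, nsmul_eq_mul]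
    exact mul_le_mul_of_nonneg_right (B.numHoles_le b) hM0
  have h6 : ∑ l, KTwo b a (x - B.center b l) - conv (B.density b) (KTwo b a) x =
      (∫ t, deriv (fun y => KTwo b a (x - y)) t * D.rem t) - ∑ d, KTwo b a (x - B.hole b d) := by
    rw [← h3]
    linarith
  rw [h6]
  refine (abs_sub _ _).trans (add_le_add (h4.trans ?_) h5)
  linarith [hM.variation]

/-- The densities of the seas solve the linear integral equations up to a bounded error. -/
theorem abs_density_add_conv_le {a : ℕ} (hP : ∀ b ∈ C.spins, 0 ≤ C.valence L B.ν b)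
    {M : ℝ} (hM : ∀ b ∈ C.spins ∪ X.newStrings.support, KernelBound b a M) (x : ℝ) :
    |B.density a x + ∑ b ∈ C.spins, conv (B.density b) (KTwo b a) x
      - L * ∑ s ∈ C.spins, C.rho s * KSite s a x| ≤
      ∑ b ∈ C.spins, (M + |holeCount C X b| * M)
        + ∑ b ∈ X.newStrings.support, (X.newStrings b : ℝ) * M := by
  have h : B.density a x + ∑ b ∈ C.spins, conv (B.density b) (KTwo b a) x
      - L * ∑ s ∈ C.spins, C.rho s * KSite s a x =
      -(∑ b ∈ C.spins, (∑ l, KTwo b a (x - B.center b l) - conv (B.density b) (KTwo b a) x)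
        + ∑ b ∈ X.newStrings.support, ∑ l, KTwo b a (x - B.center b l)) := by
    rw [density, B.sum_support_eq, Finset.sum_sub_distrib]
    ring
  rw [h, abs_neg]
  refine (abs_add_le _ _).trans (add_le_add ?_ ?_)
  · exact (Finset.abs_sum_le_sum_abs _ _).trans (Finset.sum_le_sum fun b hb =>
      B.abs_sum_center_sub_conv_le hb (hP b hb) (hM b (Finset.mem_union_left _ hb)) x)
  · refine (Finset.abs_sum_le_sum_abs _ _).trans (Finset.sum_le_sum fun b hb =>
      (Finset.abs_sum_le_sum_abs _ _).trans ((Finset.sum_le_sum fun l _ =>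
        (hM b (Finset.mem_union_right _ hb)).two _).trans ?_))
    simp [B.ν_of_mem_newStrings hb]

/-- For such L the sea is not empty, and the quantum number of any of its strings witnesses that the
allowed range is not empty. -/
theorem valence_nonneg {a : ℕ} (ha : a ∈ C.spins)
    (h : (X.removed a : ℝ) < L * (C.rho a / 2)) : 0 ≤ C.valence L B.ν a := by
  have h0 : (0 : ℝ) < B.ν a := by rw [B.ν_sea a ha]; linarith
  have h1 : 0 < B.ν a := by exact_mod_cast h0
  obtain ⟨i, hi, -⟩ := B.Q_allowed a ⟨0, h1⟩
  omega

/-- The quarter-period shift turns the sine into cos(arctan(sinh y)) = 1/√(1 + sinh² y) = 1/cosh y,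
with y = πλ̃. -/
theorem excitationEnergy_eq_sin {a : ℕ} (ha : a ∈ C.spins) : B.excitationEnergy a =
    π * ∑ d : Fin (B.numHoles a), sin (C.holeMomentum a (B.hole a d) / C.rho a) := by
  have h0 := (C.rho_pos ha).ne'
  rw [excitationEnergy, Finset.mul_sum]
  refine Finset.sum_congr rfl fun d _ => ?_
  have h1 : C.holeMomentum a (B.hole a d) / C.rho a =
      arctan (sinh (π * B.hole a d)) + π / 2 := by
    rw [Motif.holeMomentum]
    field_simp
  rw [h1, sin_add_pi_div_two, cos_arctan, add_comm (1 : ℝ), ← cosh_sq, sqrt_sq (cosh_pos _).le]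
  ring

end BetheState

/-! ### Vanishing of the remainder along a subsequence -/

theorem tendsto_integral_rem {C : Motif} {X : Excitation C} {L : ℕ → ℕ}
    (hL : ∀ n, n + 1 ≤ L n) (B : ∀ n, BetheState C X (L n))
    (hP : ∀ n, ∀ a ∈ C.spins, 0 ≤ C.valence (L n) (B n).ν a)
    (D : ∀ n a, a ∈ C.spins → CountingProfile (Fin ((B n).ν a) ⊕ Fin ((B n).numHoles a)))
    (hD : ∀ n a ha, deriv (D n a ha).u = (B n).density a)
    (hDP : ∀ n a ha, ((D n a ha).P : ℝ) = C.valence (L n) (B n).ν a) :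
    ∃ φ : ℕ → ℕ, StrictMono φ ∧ ∀ a (ha : a ∈ C.spins),
      Tendsto (fun n => ∫ x, deriv halfSech x * (D (φ n) a ha).rem x) atTop (𝓝 0) := by
  obtain ⟨M, hM0, hM⟩ := exists_uniform_kernelBound (C.spins ∪ X.newStrings.support) C.spins
  have hL1 : ∀ n, (1 : ℝ) ≤ L n := fun n => by exact_mod_cast (by have := hL n; omega : 1 ≤ L n)
  have hL0 : ∀ n, (0 : ℝ) < L n := fun n => by linarith [hL1 n]
  set N : ℝ := ∑ b ∈ C.spins, (C.rho b + |(X.removed b : ℝ)|)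
      + ∑ b ∈ X.newStrings.support, (X.newStrings b : ℝ) with hN
  have hN0 : 0 ≤ N := add_nonneg
    (Finset.sum_nonneg fun b hb => add_nonneg (C.rho_pos hb).le (abs_nonneg _))
    (Finset.sum_nonneg fun b _ => Nat.cast_nonneg _)
  set H : ℝ := ∑ b ∈ C.spins, |holeCount C X b| with hH
  have hH0 : 0 ≤ H := Finset.sum_nonneg fun b _ => abs_nonneg _
  set R : ℝ := ∑ s ∈ C.spins, C.rho s with hR
  have hR0 : 0 ≤ R := Finset.sum_nonneg fun b hb => (C.rho_pos hb).le
  set E : ℝ := ∑ b ∈ C.spins, (M + |holeCount C X b| * M)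
        + ∑ b ∈ X.newStrings.support, (X.newStrings b : ℝ) * M with hE
  have hE0 : 0 ≤ E := add_nonneg
    (Finset.sum_nonneg fun b hb => add_nonneg hM0 (mul_nonneg (abs_nonneg _) hM0))
    (Finset.sum_nonneg fun b _ => mul_nonneg (Nat.cast_nonneg _) hM0)
  -- The first summand bounds density/L and its Lipschitz constant; the second bounds (P + 1)/L, as
  -- P = ν + holes ≤ LN + H and L ≥ 1.
  set A : ℝ := (R + N) * M + (N + H + 1) with hA
  have hRN : 0 ≤ (R + N) * M := mul_nonneg (add_nonneg hR0 hN0) hM0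
  have hsize : ∀ n, (L n * R + ∑ b ∈ (B n).ν.support, ((B n).ν b : ℝ)) ≤ L n * (R + N) := fun n => by
    rw [mul_add]
    linarith [(B n).sum_ν_le (by have := hL n; omega)]
  have hvb : ∀ n, ∀ a ∈ C.spins, ∀ x, |(B n).density a x / L n| ≤ A := by
    intro n a ha x
    rw [abs_div, abs_of_pos (hL0 n), div_le_iff₀ (hL0 n)]
    have h1 := (B n).abs_density_le (fun b hb => hM b hb a ha) x
    have h2 := mul_le_mul_of_nonneg_right (hsize n) hM0
    nlinarith [hL0 n]
  have hLtop : Tendsto (fun n => (L n : ℝ)) atTop atTop :=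
    tendsto_natCast_atTop_atTop.comp
      (tendsto_atTop_mono (fun n => (by have := hL n; omega : n ≤ L n)) tendsto_id)
  have hcd : ∀ n a, Continuous fun x => (B n).density a x / L n := fun n a =>
    ((B n).continuous_density a).div_const _
  have hvl : ∀ n, ∀ a ∈ C.spins, ∀ x y,
      |(B n).density a x / L n - (B n).density a y / L n| ≤ A * |x - y| := by
    intro n a ha x y
    have h1 := (B n).abs_density_sub_le (fun b hb => hM b hb a ha) x y
    have h2 := mul_le_mul_of_nonneg_right (hsize n) (mul_nonneg hM0 (abs_nonneg (x - y)))
    rw [← sub_div, abs_div, abs_of_pos (hL0 n), div_le_iff₀ (hL0 n)]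
    have h3 : 0 ≤ (N + H + 1) * |x - y| * L n := by
      have := hL0 n
      positivity
    rw [hA]
    linarith
  have heq : ∀ n, ∀ a ∈ C.spins, ∀ x, |(B n).density a x / L n
      + ∑ b ∈ C.spins, conv (fun x => (B n).density b x / L n) (KTwo b a) x
      - ∑ p ∈ C.spins, C.rho p * KSite p a x| ≤ (E + 1) / L n := by
    intro n a ha x
    have h1 := (B n).abs_density_add_conv_le (hP n) (fun b hb => hM b hb a ha) x
    have h2 : ∀ b, conv (fun x => (B n).density b x / L n) (KTwo b a) x =
        conv ((B n).density b) (KTwo b a) x / L n := by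
      intro b
      unfold conv
      rw [← integral_div]
      congr 1
      funext y
      ring
    have h3 : (B n).density a x / L n
        + ∑ b ∈ C.spins, conv (fun x => (B n).density b x / L n) (KTwo b a) x
        - ∑ p ∈ C.spins, C.rho p * KSite p a x =
        ((B n).density a x + ∑ b ∈ C.spins, conv ((B n).density b) (KTwo b a) x
          - L n * ∑ s ∈ C.spins, C.rho s * KSite s a x) / L n := by
      simp only [h2]
      rw [← Finset.sum_div]
      have := (hL0 n).ne'
      field_simp
    rw [h3, abs_div, abs_of_pos (hL0 n)]
    -- The numerator E + 1 lets one null sequence serve twice: E for the integral equations, 1 for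
    -- the possible decrease of u.
    exact div_le_div_of_nonneg_right (by linarith) (hL0 n).le
  have hint : ∀ n, ∀ a ∈ C.spins, ∀ x y, x ≤ y → -((E + 1) / L n) ≤
      (∫ t in x..y, (B n).density a t / L n) ∧ (∫ t in x..y, (B n).density a t / L n) ≤ A := by
    intro n a ha x y hxy
    have h1 := (D n a ha).integral_deriv_mem x y hxy
    rw [hD] at h1
    rw [intervalIntegral.integral_div, ← neg_div]
    refine ⟨div_le_div_of_nonneg_right (by linarith [h1.1]) (hL0 n).le, ?_⟩
    rw [div_le_iff₀ (hL0 n)]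
    refine h1.2.trans ?_
    have h2 := (B n).valence_sub_eq a
    have h3 : holeCount C X a ≤ H := (le_abs_self _).trans
      (Finset.single_le_sum (f := fun b => |holeCount C X b|) (fun b _ => abs_nonneg _) ha)
    have h4 : ((B n).ν a : ℝ) ≤ L n * N := by
      refine le_trans ?_ ((B n).sum_ν_le (by have := hL n; omega))
      by_cases h : a ∈ (B n).ν.support
      · exact Finset.single_le_sum (f := fun b => ((B n).ν b : ℝ)) (fun b _ => Nat.cast_nonneg _) h
      · rw [Finsupp.notMem_support_iff.1 h, Nat.cast_zero]
        exact Finset.sum_nonneg fun b _ => Nat.cast_nonneg _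
    rw [hDP n a ha, hA]
    nlinarith [hL1 n]
  obtain ⟨φ, hφ, hlim⟩ := exists_subseq_tendsto_density (S := C.spins)
    (fun a ha => C.one_le_of_mem_spins ha) C.rho
    (fun n a x => (B n).density a x / L n) A (fun n => (E + 1) / L n)
    (hLtop.const_div_atTop _) hvb hvl heq hint
  refine ⟨φ, hφ, fun a ha => ?_⟩
  refine tendsto_integral_deriv_halfSech_mul (v := fun n x => (B (φ n)).density a x / L (φ n))
    (C.rho_pos ha) (fun n => (D (φ n) a ha).measurable_rem)
    (fun n => (D (φ n) a ha).abs_rem_le) (fun n => hcd _ a) (fun n => hvb _ a ha) (hlim a ha) ?_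
  intro g hg
  have h0 : Tendsto (fun n => (∫ t, |deriv g t|) / L (φ n)) atTop (𝓝 0) :=
    (hLtop.const_div_atTop _).comp hφ.tendsto_atTop
  refine squeeze_zero_norm (fun n => ?_) h0
  have h1 := (D (φ n) a ha).abs_integral_mul_rem_mul_deriv_le hg
  rw [hD] at h1
  simp only [← mul_div_assoc]
  rw [integral_div, norm_eq_abs, abs_div, abs_of_pos (hL0 _)]
  exact div_le_div_of_nonneg_right h1 (hL0 _).le

end RegularSpinChain

end

/-! ### The theorem -/

theorem theorem2 (C : RegularSpinChain.Motif) (X : RegularSpinChain.Excitation C) :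
    (∀ ε : ℝ, 0 < ε → ∃ L₁ : ℕ, ∀ L : ℕ, L₁ ≤ L → ∀ B : RegularSpinChain.BetheState C X L,
      ∀ a ∈ C.spins,
        |B.energy a / L - (C.vacuumEnergy a + 1 / (L : ℝ) * B.excitationEnergy a)| ≤ ε / L) ∧
    (∀ (L : ℕ) (B : RegularSpinChain.BetheState C X L), ∀ a ∈ C.spins,
      B.excitationEnergy a =
        Real.pi * ∑ d : Fin (B.numHoles a), Real.sin (C.holeMomentum a (B.hole a d) / C.rho a)) := by
  refine ⟨fun ε hε => ?_, fun L B a ha => B.excitationEnergy_eq_sin ha⟩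
  -- Failure of uniformity gives a sequence of bad states of unbounded length; a contradiction along
  -- one subsequence is enough.
  by_contra! hcon
  have hlarge : ∀ᶠ L : ℕ in Filter.atTop, ∀ a ∈ C.spins,
      (X.removed a : ℝ) < L * (C.rho a / 2) := by
    rw [Filter.eventually_all_finset]
    intro a ha
    exact (tendsto_natCast_atTop_atTop.atTop_mul_const
      (half_pos (C.rho_pos ha))).eventually_gt_atTop _
  obtain ⟨L₀, hL₀⟩ := Filter.eventually_atTop.1 hlarge
  -- The bound n + 1 makes the lengths positive and divergent; L₀ ensures nonnegative valences.
  choose L hL B a ha herr using fun n : ℕ => hcon (max (n + 1) L₀)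
  have hP : ∀ n, ∀ a ∈ C.spins, 0 ≤ C.valence (L n) (B n).ν a := fun n a ha =>
    (B n).valence_nonneg ha (hL₀ _ ((le_max_right _ _).trans (hL n)) a ha)
  choose D hpt hu hDP using fun n a (ha : a ∈ C.spins) => (B n).exists_profile ha (hP n a ha)
  obtain ⟨φ, -, hφ⟩ := RegularSpinChain.tendsto_integral_rem
    (fun n => (le_max_left _ _).trans (hL n)) B hP D hu hDP
  have hsmall : ∀ᶠ n in Filter.atTop, ∀ a (ha : a ∈ C.spins),
      |2 * Real.pi * ∫ x, deriv RegularSpinChain.halfSech x * (D (φ n) a ha).rem x| < ε := by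
    -- The offending spin may vary with n, so the estimate is made for the finitely many spins at
    -- once.
    have := (Filter.eventually_all (ι := C.spins)).2 fun a =>
      ((hφ a a.2).const_mul (2 * Real.pi)).abs.eventually
        (gt_mem_nhds (show |2 * Real.pi * 0| < ε by simpa using hε))
    filter_upwards [this] with n hn a ha using hn ⟨a, ha⟩
  obtain ⟨n, hn⟩ := hsmall.exists
  have h1 := hn _ (ha (φ n))
  have h2 := (B (φ n)).energy_sub_eq (ha (φ n)) (hpt (φ n) _ (ha (φ n))) (hu (φ n) _ (ha (φ n)))
  have hLpos : (0 : ℝ) < L (φ n) := by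
    have := (le_max_left _ _).trans (hL (φ n))
    exact_mod_cast (by omega : 0 < L (φ n))
  refine absurd (herr (φ n)) (not_lt.2 ?_)
  have h3 : ∀ e v x l : ℝ, 0 < l → e / l - (v + 1 / l * x) = (e - (l * v + x)) / l := by
    intro e v x l hl
    field_simp
  rw [h3 _ _ _ _ hLpos, h2, abs_div, abs_of_pos hLpos, neg_mul, abs_neg]
  exact div_le_div_of_nonneg_right h1.le hLpos.le
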